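/- Latency functions are non-decreasing functions $f:\mathbb{R}_{>0}\to\mathbb{R}_{>0}$, extended by $f(0):=\lim_{x\to0^+}f(x)$. A weighted congestion game has a finite set $N$ of at least two players with weights $w_i\ge 0$, a finite set $E$ of resources with latency functions $\ell_e$, and for each player $i$ a non-empty set $\Sigma_i$ of non-empty subsets of $E$ (her strategies); it is a load balancing game if all strategies are singletons. For an assignment $\sigma=(\sigma_i)_{i\in N}$ of subsets of $E$ to the players (where $\sigma_i=\emptyset$ if $i$ has not entered the game), let $k_e(\sigma)=\sum_{i:e\in\sigma_i}w_i$, $cost_i(\sigma)=\sum_{e\in\sigma_i}\ell_e(k_e(\sigma))$ and $\mathrm{SUM}(\sigma)=\sum_i w_i\,cost_i(\sigma)$. Let $\epsilon\ge 0$. In an $\epsilon$-approximate one-round walk the players arrive one by one, in an arbitrary order, and each arriving player $i$ irrevocably chooses a strategy. If $\sigma$ is the state before her arrival and $(\sigma,S)$ the state after she has chosen $S$, then her choice $\sigma_i\in\Sigma_i$ must satisfy, for all $S\in\Sigma_i$, $cost_i(\sigma,\sigma_i)\le(1+\epsilon)\,cost_i(\sigma,S)$ if players are selfish, and $\mathrm{SUM}(\sigma,\sigma_i)-\mathrm{SUM}(\sigma)\le(1+\epsilon)\,(\mathrm{SUM}(\sigma,S)-\mathrm{SUM}(\sigma))$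 if players are cooperative. The competitive ratio $\mathsf{CR}^s_\epsilon$ (selfish players), resp. $\mathsf{CR}^c_\epsilon$ (cooperative players), of a game is the maximum of $\mathrm{SUM}(\sigma)/\mathrm{SUM}(\sigma^*)$ over the final profiles $\sigma$ of such walks, where $\sigma^*$ is a strategy profile minimizing $\mathrm{SUM}$; that of a class of games is the supremum over its games. For a class $\mathcal{C}$ of latency functions let $\mathsf{W}(\mathcal{C})$ and $\mathsf{WLB}(\mathcal{C})$ be the classes of weighted congestion games and of weighted load balancing games with all latency functions in $\mathcal{C}$. For $k,o>0$ put $$\beta(\mathsf{CR}^s_\epsilon,k,o,f)=-\int_0^kf(t)\,dt+(1+\epsilon)\,o f(k+o),$$ $$\beta(\mathsf{CR}^c_\epsilon,k,o,f)=-kf(k)+(1+\epsilon)\big((k+o)f(k+o)-kf(k)\big),$$ and for $\mathsf{EM}\in\{\mathsf{CR}^s_\epsilon,\mathsf{CR}^c_\epsilon\}$, with $f$ ranging over the latency functions occurring in games of the class $\mathcal{G}$, $$\gamma_{\mathsf W}(\mathsf{EM},\mathcal{G})=\inf_{x\ge1}\ \sup_{f,\;k>0,\;o>0}\frac{kf(k)+x\,\beta(\mathsf{EM},k,o,f)}{o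 f(o)}.$$ **Theorem.** Let $\mathcal{C}$ be a class of latency functions that contains a non-constant function and is closed under ordinate and abscissa scaling, i.e. for every $f\in\mathcal{C}$ and $\alpha>0$ the functions $x\mapsto\alpha f(x)$ and $x\mapsto f(\alpha x)$ belong to $\mathcal{C}$. Then, for every $\epsilon\ge0$, as elements of the extended reals, $$\gamma_{\mathsf W}(\mathsf{CR}^s_\epsilon,\mathsf{W}(\mathcal{C}))=\mathsf{CR}^s_\epsilon(\mathsf{W}(\mathcal{C}))=\mathsf{CR}^s_\epsilon(\mathsf{WLB}(\mathcal{C})).$$ If moreover every $f\in\mathcal{C}$ is semi-convex (i.e. $x\mapsto xf(x)$ is convex), then $$\gamma_{\mathsf W}(\mathsf{CR}^c_\epsilon,\mathsf{W}(\mathcal{C}))=\mathsf{CR}^c_\epsilon(\mathsf{W}(\mathcal{C}))=\mathsf{CR}^c_\epsilon(\mathsf{WLB}(\mathcal{C})).$$ -/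

import Mathlib

open scoped NNReal

namespace CongestionGames

/-- A latency function: a non-decreasing function from the positive reals to the positive reals,
extended to `0` by its right limit there. -/
structure Latency where
  toFun : ℝ≥0 → ℝ≥0
  pos_of_pos : ∀ x, 0 < x → 0 < toFun x
  monotone : Monotone toFun
  tendsto_zero : Filter.Tendsto toFun (nhdsWithin 0 (Set.Ioi 0)) (nhds (toFun 0))

instance : CoeFun Latency (fun _ => ℝ≥0 → ℝ≥0) := ⟨Latency.toFun⟩

/-- The latency function is constant. -/
def Latency.IsConstant (f : Latency) : Prop :=
  ∀ x y, f x = f y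

/-- `f` is semi-convex if `x ↦ x * f x` is convex on the non-negative reals. -/
def Latency.SemiConvex (f : Latency) : Prop :=
  ConvexOn ℝ (Set.Ici (0 : ℝ)) (fun x : ℝ => x * (f x.toNNReal : ℝ))

/-- Closure under ordinate scaling: with `f`, the class contains `x ↦ α * f x` for all `α > 0`. -/
def ClosedUnderOrdinateScaling (C : Set Latency) : Prop :=
  ∀ f ∈ C, ∀ α : ℝ≥0, 0 < α → ∃ g ∈ C, ∀ x, g x = α * f x

/-- Closure under abscissa scaling: with `f`, the class contains `x ↦ f (α * x)` for all `α > 0`. -/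
def ClosedUnderAbscissaScaling (C : Set Latency) : Prop :=
  ∀ f ∈ C, ∀ α : ℝ≥0, 0 < α → ∃ g ∈ C, ∀ x, g x = f (α * x)

/-- A (weighted) congestion game: finitely many, but at least two, players, finitely many
resources, a latency function for every resource, a weight for every player, and for every player
a non-empty set of strategies, each of which is a non-empty set of resources. -/
structure CongestionGame where
  Player : Type
  Resource : Type
  [fintypePlayer : Fintype Player]
  [decidableEqPlayer : DecidableEq Player]
  [fintypeResource : Fintype Resource]
  [decidableEqResource : DecidableEq Resource]
  two_le_card : 2 ≤ Fintype.card Player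
  latency : Resource → Latency
  weight : Player → ℝ≥0
  strategies : Player → Set (Finset Resource)
  strategies_nonempty : ∀ i, (strategies i).Nonempty
  nonempty_of_mem : ∀ i, ∀ S ∈ strategies i, S.Nonempty

attribute [instance] CongestionGame.fintypePlayer CongestionGame.decidableEqPlayer
  CongestionGame.fintypeResource CongestionGame.decidableEqResource

namespace CongestionGame

variable (G : CongestionGame)

/-- An assignment of a set of resources to every player. The empty set stands for a player who has
not entered the game. -/
abbrev Assignment : Type := G.Player → Finset G.Resource

/-- Strategy profiles: every player plays one of her strategies. -/
def IsProfile (σ : G.Assignment) : Prop :=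
  ∀ i, σ i ∈ G.strategies i

/-- The congestion `k_e(σ)`: the total weight of the players using `e`. -/
def congestion (σ : G.Assignment) (e : G.Resource) : ℝ≥0 :=
  ∑ i with e ∈ σ i, G.weight i

/-- The personal cost of player `i`. -/
def cost (i : G.Player) (σ : G.Assignment) : ℝ :=
  ∑ e ∈ σ i, (G.latency e (G.congestion σ e) : ℝ)

/-- The social function `SUM`: the weighted sum of the personal costs. -/
def social (σ : G.Assignment) : ℝ :=
  ∑ i, (G.weight i : ℝ) * G.cost i σ

/-- A social optimum is a strategy profile minimizing `SUM`. -/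
def IsSocialOptimum (σ : G.Assignment) : Prop :=
  G.IsProfile σ ∧ ∀ ρ, G.IsProfile ρ → G.social σ ≤ G.social ρ

/-- An order of arrival of the players: `π i` is the number of players arriving before `i`. -/
abbrev ArrivalOrder : Type := G.Player ≃ Fin (Fintype.card G.Player)

/-- The state after the first `t` players have made the choices prescribed by `σ`, while the
others have not entered yet. -/
def partialState (π : G.ArrivalOrder) (σ : G.Assignment) (t : ℕ) : G.Assignment :=
  fun i => if (π i : ℕ) < t then σ i else ∅

end CongestionGame

/-- The two kinds of players in a one-round walk. -/
inductive PlayerKind where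
  | selfish
  | cooperative

namespace CongestionGame

variable (G : CongestionGame)

/-- The quantity that player `i`, arriving in state `σ`, aims at minimizing over her strategies
`S`: her personal cost after choosing `S` (selfish players), or the increase of the social
function caused by choosing `S` (cooperative players). -/
def arrivalCost (kind : PlayerKind) (σ : G.Assignment) (i : G.Player)
    (S : Finset G.Resource) : ℝ :=
  match kind with
  | .selfish => G.cost i (Function.update σ i S)
  | .cooperative => G.social (Function.update σ i S) - G.social σ

/-- The profile `σ` is generated by an `ε`-approximate one-round walk in which the players arrive
in the order `π`: the choice of each player is, up to the factor `1 + ε`, at least as good as each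
of her strategies at the time of her arrival. -/
def IsOneRoundWalk (kind : PlayerKind) (ε : ℝ) (π : G.ArrivalOrder) (σ : G.Assignment) : Prop :=
  G.IsProfile σ ∧ ∀ i, ∀ S ∈ G.strategies i,
    G.arrivalCost kind (G.partialState π σ (π i)) i (σ i) ≤
      (1 + ε) * G.arrivalCost kind (G.partialState π σ (π i)) i S

/-- The profiles generated by some `ε`-approximate one-round walk. -/
def oneRoundWalks (kind : PlayerKind) (ε : ℝ) : Set G.Assignment :=
  {σ | ∃ π, G.IsOneRoundWalk kind ε π σ}

/-- The competitive ratio of `ε`-approximate one-round walks in the game `G`: the largest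
`SUM(σ) / SUM(σ*)` over the profiles `σ` generated by a walk, where `σ*` is a social optimum.
`SUM(σ*) = 0` occurs only if all weights are `0`, and then `SUM(σ) = 0` and the ratio reads `0`. -/
noncomputable def competitiveRatio (kind : PlayerKind) (ε : ℝ) : EReal :=
  ⨆ σ ∈ G.oneRoundWalks kind ε, ⨆ ρ ∈ {ρ | G.IsSocialOptimum ρ},
    ((G.social σ / G.social ρ : ℝ) : EReal)

/-- Load balancing games: all strategies are singletons. -/
def IsLoadBalancing : Prop :=
  ∀ i, ∀ S ∈ G.strategies i, S.card = 1

end CongestionGame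

/-- `W(C)`: the weighted congestion games with latency functions in `C`. -/
def weightedGames (C : Set Latency) : Set CongestionGame :=
  {G | ∀ e, G.latency e ∈ C}

/-- `WLB(C)`: the weighted load balancing games with latency functions in `C`. -/
def weightedLoadBalancingGames (C : Set Latency) : Set CongestionGame :=
  {G | G ∈ weightedGames C ∧ G.IsLoadBalancing}

/-- The class of the latency functions of the games in `𝒢`. -/
def latencyClass (𝒢 : Set CongestionGame) : Set Latency :=
  {f | ∃ G ∈ 𝒢, ∃ e, G.latency e = f}

/-- The competitive ratio of `ε`-approximate one-round walks over a class of games. -/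
noncomputable def classCompetitiveRatio (kind : PlayerKind) (ε : ℝ)
    (𝒢 : Set CongestionGame) : EReal :=
  ⨆ G ∈ 𝒢, CongestionGame.competitiveRatio G kind ε

/-- The quantity `β_W`. -/
noncomputable def betaW (kind : PlayerKind) (ε : ℝ) (k o : ℝ≥0) (f : Latency) : ℝ :=
  match kind with
  | .selfish =>
      -(∫ t in (0 : ℝ)..(k : ℝ), (f t.toNNReal : ℝ)) + (1 + ε) * ((o : ℝ) * f (k + o))
  | .cooperative =>
      -((k : ℝ) * f k) + (1 + ε) * (((k : ℝ) + o) * f (k + o) - (k : ℝ) * f k)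

/-- The quantity `γ_W` at fixed parameters `x`, `k`, `o`, `f`. -/
noncomputable def gammaWAt (kind : PlayerKind) (ε x : ℝ) (k o : ℝ≥0) (f : Latency) : ℝ :=
  ((k : ℝ) * f k + x * betaW kind ε k o f) / ((o : ℝ) * f o)

/-- `γ_W` of a class of games: the infimum over `x ≥ 1` of the supremum over the latency functions
`f` of the class and over `k, o > 0`. -/
noncomputable def gammaW (kind : PlayerKind) (ε : ℝ) (𝒢 : Set CongestionGame) : EReal :=
  ⨅ x ∈ Set.Ici (1 : ℝ), ⨆ f ∈ latencyClass 𝒢, ⨆ k ∈ Set.Ioi (0 : ℝ≥0),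
    ⨆ o ∈ Set.Ioi (0 : ℝ≥0), ((gammaWAt kind ε x k o f : ℝ) : EReal)

end CongestionGames

/-!
Both kinds of players are treated at once. Multiply the walk condition of a selfish player by her
weight; then for either kind it compares sums of marginal costs `marginal kind f t w` of putting
weight `w` on a resource of latency `f` and load `t`, and `β = (1 + ε) * marginal f k o -
potential f k`, where `potential f k` is the marginal cost of filling an empty resource up to `k`
with infinitesimal players. What matters is that the marginal cost is increasing in the load (for
cooperative players this is semi-convexity), superadditive in the weight, and at least the increase
of the potential. Write `A = k * f k` and `D = o * f o` for the costs of a resource in the walk and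
in the optimum.

*Upper bound.* Summing the walk conditions, with the optimum as alternative, gives `∑ β ≥ 0` over
the resources (`CongestionGame.IsOneRoundWalk.sum_betaW_nonneg`). If `A + x * β ≤ Γ * D` for all
`f` and all loads, summation yields `SUM(σ) ≤ Γ * SUM(σ*)`; vanishing loads are reached by a limit
(`add_betaW_le_of_gammaWAt_le`).

*Lower bound.* Let `0 ≤ γ < γ_W`. Then for every `x ≥ 1` some load pattern `(f, k, o)` satisfies
`A - γ * D + x * β > 0`. Since these are affine functions of `x`, one pattern with `β ≥ 0` works at
`x = 1`, or two patterns with `β` of opposite signs work at the same `x`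
(`exists_nonneg_slope_or_opposite_slopes`). In the first case the load `k` is raised until the
slack `β` has become walk cost, so that even `A > γ * D` (`LoadPattern.exists_raised`).

These patterns are put on the levels of an `N`-ary tree whose nodes are the resources and whose
edges are the players. A player chooses between the upper end of her edge, which she does in the
walk, and the lower end, which she does in the optimum; players arrive from the leaves to the root.
So each player finds the full walk load on her lower resource, while the `N` players of a node
fill it up in small steps, at a total marginal cost close to the potential for large `N`. Abscissa
scaling fits the weights to the loads and ordinate scaling makes the choices of the walk
acceptable. Let `L s` be the total of `(1 + ε) * marginal f k o` over the nodes of depth `s`; it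
can be made to follow any sequence that grows by at least the factor
`potential / ((1 + ε) * marginal)` of the pattern at that level, up to the error of the grid. As
`A - γ * D > x * (potential - (1 + ε) * marginal)`, the gain `A - γ * D` summed over level `s`
exceeds `x * (L (s + 1) - L s)` by a fixed amount. This telescopes: if two patterns alternate in
such a way that `L` stays bounded, or a single pattern makes `L` grow slowly enough, a deep tree
has ratio at least `γ` (`Schedule.exists_of_lt`, `Schedule.exists_depth`,
`Schedule.le_classCompetitiveRatio`).
-/

open scoped NNReal

namespace CongestionGames

/-! ### Marginal costs and potentials -/

/-- The increase of the objective of an arriving player, multiplied by her weight for selfish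
players: a player of weight `w` enters a resource of latency `f` and load `t`, and pays
`w * f (t + w)` if she is selfish, or causes the increase `(t + w) * f (t + w) - t * f t` of the
social function if she is cooperative. -/
def marginal (kind : PlayerKind) (f : Latency) (t w : ℝ≥0) : ℝ :=
  match kind with
  | .selfish => (w : ℝ) * f (t + w)
  | .cooperative => ((t : ℝ) + w) * f (t + w) - (t : ℝ) * f t

/-- The limit of the total marginal cost of loading an empty resource up to `k` by infinitesimal
players. -/
noncomputable def potential (kind : PlayerKind) (f : Latency) (k : ℝ≥0) : ℝ :=
  match kind with
  | .selfish => ∫ t in (0 : ℝ)..(k : ℝ), (f t.toNNReal : ℝ)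
  | .cooperative => (k : ℝ) * f k

/-- The condition on latency functions under which the marginal cost is monotone in the load:
none for selfish players, semi-convexity for cooperative ones. -/
def Admissible (kind : PlayerKind) (f : Latency) : Prop :=
  kind = .cooperative → f.SemiConvex

theorem betaW_eq (kind : PlayerKind) (ε : ℝ) (k o : ℝ≥0) (f : Latency) :
    betaW kind ε k o f = -potential kind f k + (1 + ε) * marginal kind f k o := by
  cases kind <;> rfl

theorem Latency.mono_real (f : Latency) {x y : ℝ≥0} (h : x ≤ y) : (f x : ℝ) ≤ f y :=
  NNReal.coe_le_coe.2 (f.monotone h)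

theorem Latency.pos_real (f : Latency) {x : ℝ≥0} (h : 0 < x) : (0 : ℝ) < f x :=
  NNReal.coe_pos.2 (f.pos_of_pos x h)

theorem Latency.monotone_toNNReal (f : Latency) : Monotone fun t : ℝ => (f t.toNNReal : ℝ) :=
  fun _ _ h => f.mono_real (Real.toNNReal_mono h)

theorem Latency.intervalIntegrable (f : Latency) (a b : ℝ) :
    IntervalIntegrable (fun t : ℝ => (f t.toNNReal : ℝ)) MeasureTheory.volume a b :=
  f.monotone_toNNReal.intervalIntegrable

theorem Latency.integral_le (f : Latency) {a b : ℝ≥0} (h : a ≤ b) :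
    ∫ t in (a : ℝ)..b, (f t.toNNReal : ℝ) ≤ ((b : ℝ) - a) * f b := by
  have h' : (a : ℝ) ≤ b := h
  have := intervalIntegral.integral_mono_on h' (f.intervalIntegrable a b)
    (intervalIntegrable_const (c := (f b : ℝ))) (fun x hx => by
      have := f.monotone_toNNReal hx.2
      simpa using this)
  simpa using this

theorem Latency.le_integral (f : Latency) {a b : ℝ≥0} (h : a ≤ b) :
    ((b : ℝ) - a) * f a ≤ ∫ t in (a : ℝ)..b, (f t.toNNReal : ℝ) := by
  have h' : (a : ℝ) ≤ b := h
  have := intervalIntegral.integral_mono_on h' (intervalIntegrable_const (c := (f a : ℝ)))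
    (f.intervalIntegrable a b) (fun x hx => by
      have := f.monotone_toNNReal hx.1
      simpa using this)
  simpa using this

theorem Latency.integral_sub (f : Latency) (a b : ℝ≥0) :
    (∫ t in (0 : ℝ)..b, (f t.toNNReal : ℝ)) - (∫ t in (0 : ℝ)..a, (f t.toNNReal : ℝ)) =
      ∫ t in (a : ℝ)..b, (f t.toNNReal : ℝ) :=
  intervalIntegral.integral_interval_sub_left (f.intervalIntegrable _ _) (f.intervalIntegrable _ _)

section Marginal

variable {kind : PlayerKind} {f : Latency}

theorem potential_zero (kind : PlayerKind) (f : Latency) : potential kind f 0 = 0 := by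
  cases kind <;> simp [potential]

theorem marginal_zero (kind : PlayerKind) (f : Latency) (t : ℝ≥0) : marginal kind f t 0 = 0 := by
  cases kind <;> simp [marginal]

theorem marginal_from_zero (kind : PlayerKind) (f : Latency) (w : ℝ≥0) :
    marginal kind f 0 w = (w : ℝ) * f w := by
  cases kind <;> simp [marginal]

theorem marginal_pos (kind : PlayerKind) (f : Latency) (t : ℝ≥0) {w : ℝ≥0} (hw : 0 < w) :
    0 < marginal kind f t w := by
  have hw' : (0 : ℝ) < w := hw
  have h1 := f.pos_real (add_pos_of_nonneg_of_pos t.2 hw)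
  cases kind with
  | selfish => exact mul_pos hw' h1
  | cooperative =>
    have h2 := f.mono_real (le_self_add : t ≤ t + w)
    have h3 := mul_le_mul_of_nonneg_left h2 t.2
    simp only [marginal]
    have h4 := mul_pos hw' h1
    have h5 : ((t : ℝ) + w) * f (t + w) = (t : ℝ) * f (t + w) + w * f (t + w) := by ring
    rw [h5]
    have h6 : (t : ℝ) * f t ≤ (t : ℝ) * f (t + w) := h3
    linarith

theorem marginal_nonneg (kind : PlayerKind) (f : Latency) (t w : ℝ≥0) :
    0 ≤ marginal kind f t w := by
  rcases eq_or_lt_of_le (zero_le (a := w)) with rfl | h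
  · rw [marginal_zero]
  · exact (marginal_pos kind f t h).le

/-- A single player never pays less than the infinitesimal players she replaces. -/
theorem potential_add_sub_le (kind : PlayerKind) (f : Latency) (t w : ℝ≥0) :
    potential kind f (t + w) - potential kind f t ≤ marginal kind f t w := by
  cases kind with
  | selfish =>
    have := f.integral_le (le_self_add : t ≤ t + w)
    rw [← f.integral_sub] at this
    simpa [potential, marginal] using this
  | cooperative => simp [potential, marginal]

theorem Latency.SemiConvex.increment_le (hf : f.SemiConvex) {t t' : ℝ≥0} (h : t ≤ t') (w : ℝ≥0) :
    ((t : ℝ) + w) * f (t + w) - (t : ℝ) * f t ≤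
      ((t' : ℝ) + w) * f (t' + w) - (t' : ℝ) * f t' := by
  rcases eq_or_lt_of_le h with rfl | h
  · rfl
  rcases eq_or_lt_of_le (zero_le (a := w)) with rfl | hw
  · simp
  have h' : (t : ℝ) < t' := h
  have hw' : (0 : ℝ) < w := hw
  -- the two inner points are convex combinations of the two outer ones with exchanged coefficients
  set d : ℝ := (t' : ℝ) + w - t with hd
  have hdpos : 0 < d := by simp only [hd]; linarith
  have m1 : (t : ℝ) ∈ Set.Ici (0 : ℝ) := t.2
  have m2 : ((t' : ℝ) + w) ∈ Set.Ici (0 : ℝ) := (t' + w).2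
  have hab : ((t' : ℝ) - t) / d + (w : ℝ) / d = 1 := by
    rw [← add_div, div_eq_one_iff_eq hdpos.ne']
    simp only [hd]
    ring
  have ha : 0 ≤ ((t' : ℝ) - t) / d := div_nonneg (by linarith) hdpos.le
  have hb : 0 ≤ (w : ℝ) / d := div_nonneg w.2 hdpos.le
  have c1 := hf.2 m1 m2 ha hb hab
  have c2 := hf.2 m1 m2 hb ha (by rw [add_comm, hab])
  have e1 : ((t' : ℝ) - t) / d * (t : ℝ) + w / d * ((t' : ℝ) + w) = t + w := by
    field_simp; simp only [hd]; ring
  have e2 : (w : ℝ) / d * (t : ℝ) + ((t' : ℝ) - t) / d * ((t' : ℝ) + w) = t' := by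
    field_simp; simp only [hd]; ring
  simp only [smul_eq_mul, e1, e2] at c1 c2
  have n1 : ((t : ℝ) + w).toNNReal = t + w := by
    rw [← NNReal.coe_add, Real.toNNReal_coe]
  have n2 : ((t' : ℝ) + w).toNNReal = t' + w := by
    rw [← NNReal.coe_add, Real.toNNReal_coe]
  simp only [n1, n2, Real.toNNReal_coe] at c1 c2
  have hb' : (w : ℝ) / d = 1 - ((t' : ℝ) - t) / d := by linarith
  rw [hb'] at c1 c2
  linarith

theorem marginal_mono (hf : Admissible kind f) {t t' : ℝ≥0} (h : t ≤ t') (w : ℝ≥0) :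
    marginal kind f t w ≤ marginal kind f t' w := by
  cases kind with
  | selfish => exact mul_le_mul_of_nonneg_left (f.mono_real (by gcongr)) w.2
  | cooperative => exact (hf rfl).increment_le h w

theorem marginal_add_le (hf : Admissible kind f) (t w w' : ℝ≥0) :
    marginal kind f t w + marginal kind f t w' ≤ marginal kind f t (w + w') := by
  cases kind with
  | selfish =>
    have h1 : (f (t + w) : ℝ) ≤ f (t + (w + w')) := f.mono_real (by gcongr; exact le_self_add)
    have h2 : (f (t + w') : ℝ) ≤ f (t + (w + w')) := f.mono_real (by gcongr; exact le_add_self)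
    have h3 := mul_le_mul_of_nonneg_left h1 w.2
    have h4 := mul_le_mul_of_nonneg_left h2 w'.2
    simp only [marginal]
    push_cast
    rw [add_mul]
    exact add_le_add h3 h4
  | cooperative =>
    have h := (hf rfl).increment_le (le_self_add : t ≤ t + w) w'
    simp only [marginal]
    rw [← add_assoc t w w']
    push_cast at h ⊢
    rw [← add_assoc]
    linarith

theorem sum_marginal_le (hf : Admissible kind f) (t : ℝ≥0) {ι : Type*} (s : Finset ι)
    (w : ι → ℝ≥0) : ∑ i ∈ s, marginal kind f t (w i) ≤ marginal kind f t (∑ i ∈ s, w i) := by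
  classical
  induction s using Finset.induction_on with
  | empty => simp [marginal_zero]
  | insert a s ha ih =>
    rw [Finset.sum_insert ha, Finset.sum_insert ha]
    exact (add_le_add le_rfl ih).trans (marginal_add_le hf t _ _)

/-- Behaviour of the marginal cost under ordinate and abscissa scaling. -/
theorem marginal_scale (kind : PlayerKind) {f g : Latency} {a l : ℝ≥0} (hl : 0 < l)
    (hg : ∀ x, g x = a * f (l⁻¹ * x)) (t w : ℝ≥0) :
    marginal kind g (l * t) (l * w) = a * l * marginal kind f t w := by
  have h : ∀ x, g (l * x) = a * f x := fun x => by
    rw [hg, inv_mul_cancel_left₀ hl.ne']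
  cases kind with
  | selfish =>
    simp only [marginal, ← mul_add, h]
    push_cast
    ring
  | cooperative =>
    simp only [marginal, ← mul_add, h]
    push_cast
    ring

theorem sub_potential_mono (kind : PlayerKind) (f : Latency) {k k' : ℝ≥0} (h : k ≤ k') :
    (k : ℝ) * f k - potential kind f k ≤ (k' : ℝ) * f k' - potential kind f k' := by
  cases kind with
  | selfish =>
    have h1 := f.integral_le h
    rw [← f.integral_sub] at h1
    have h2 := mul_le_mul_of_nonneg_left (f.mono_real h) k.2
    have h3 : (k : ℝ) * f k ≤ k * f k' := h2
    simp only [potential]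
    linarith
  | cooperative => simp [potential]

theorem potential_le (kind : PlayerKind) (f : Latency) (k : ℝ≥0) :
    potential kind f k ≤ (k : ℝ) * f k := by
  have := potential_add_sub_le kind f 0 k
  rw [zero_add, potential_zero, sub_zero, marginal_from_zero] at this
  exact this

theorem le_potential (kind : PlayerKind) (f : Latency) {k k' : ℝ≥0} (h : k ≤ k') :
    ((k' : ℝ) - k) * f k ≤ potential kind f k' := by
  cases kind with
  | selfish =>
    have h1 := f.le_integral h
    rw [← f.integral_sub] at h1
    have h2 := f.le_integral (zero_le (a := k))
    have h3 : 0 ≤ ((k : ℝ) - (0 : ℝ≥0)) * f 0 := by simp; positivity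
    simp only [potential]
    have h4 : (0 : ℝ) ≤ ∫ t in (0 : ℝ)..k, (f t.toNNReal : ℝ) := by
      simpa using h3.trans h2
    linarith
  | cooperative =>
    have h2 := mul_le_mul_of_nonneg_left (f.mono_real h) k'.2
    have h3 : (k' : ℝ) * f k ≤ k' * f k' := h2
    have h4 : (0 : ℝ) ≤ k * f k := by positivity
    simp only [potential]
    linarith

/-- The total marginal cost of loading an empty resource up to `k` by `N` equal players. -/
noncomputable def gridCost (kind : PlayerKind) (f : Latency) (N : ℕ) (k : ℝ≥0) : ℝ :=
  ∑ j ∈ Finset.range N, marginal kind f (j * (k / N)) (k / N)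

theorem potential_le_gridCost (kind : PlayerKind) (f : Latency) {N : ℕ} (hN : 0 < N) (k : ℝ≥0) :
    potential kind f k ≤ gridCost kind f N k := by
  have h : ∀ j ∈ Finset.range N, potential kind f ((j + 1 : ℕ) * (k / N)) -
      potential kind f (j * (k / N)) ≤ marginal kind f (j * (k / N)) (k / N) := fun j _ => by
    have := potential_add_sub_le kind f (j * (k / N)) (k / N)
    rwa [show (j : ℝ≥0) * (k / N) + k / N = (j + 1 : ℕ) * (k / N) by push_cast; ring] at this
  have h2 := Finset.sum_le_sum h
  rw [Finset.sum_range_sub (fun j => potential kind f (j * (k / N)))] at h2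
  have hN' : (N : ℝ≥0) ≠ 0 := by exact_mod_cast hN.ne'
  rw [mul_div_cancel₀ _ hN'] at h2
  simpa [gridCost, potential_zero] using h2

theorem gridCost_le (kind : PlayerKind) (f : Latency) {N : ℕ} (hN : 0 < N) (k : ℝ≥0) :
    gridCost kind f N k ≤ potential kind f k + (k : ℝ) * f k / N := by
  have hN' : (N : ℝ≥0) ≠ 0 := by exact_mod_cast hN.ne'
  have hc : (N : ℝ≥0) * (k / N) = k := mul_div_cancel₀ _ hN'
  have hs : ∀ j : ℕ, (j : ℝ≥0) * (k / N) + k / N = (j + 1 : ℕ) * (k / N) := fun j => by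
    push_cast; ring
  cases kind with
  | selfish =>
    have h : ∀ j ∈ Finset.range N, marginal .selfish f (j * (k / N)) (k / N) -
        ((((k / N : ℝ≥0) : ℝ) * f ((j + 1 : ℕ) * (k / N))) -
          ((k / N : ℝ≥0) : ℝ) * f (j * (k / N))) ≤
        potential .selfish f ((j + 1 : ℕ) * (k / N)) - potential .selfish f (j * (k / N)) :=
      fun j _ => by
        have := f.le_integral (show (j : ℝ≥0) * (k / N) ≤ (j : ℝ≥0) * (k / N) + k / N from
          le_self_add)
        rw [← f.integral_sub] at this
        simp only [marginal, potential]
        rw [hs] at this ⊢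
        have e : ((((j + 1 : ℕ) : ℝ≥0) * (k / N) : ℝ≥0) : ℝ) - ((j * (k / N) : ℝ≥0) : ℝ) =
          ((k / N : ℝ≥0) : ℝ) := by push_cast; ring
        rw [e] at this
        linarith
    have h2 := Finset.sum_le_sum h
    rw [Finset.sum_range_sub (fun j => potential .selfish f (j * (k / N))),
      Finset.sum_sub_distrib,
      Finset.sum_range_sub (fun j => ((k / N : ℝ≥0) : ℝ) * f (j * (k / N))), hc] at h2
    simp only [Nat.cast_zero, zero_mul, potential_zero] at h2
    have h3 : (0 : ℝ) ≤ ((k / N : ℝ≥0) : ℝ) * f 0 := by positivity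
    have h4 : ((k / N : ℝ≥0) : ℝ) * f k = (k : ℝ) * f k / N := by push_cast; ring
    rw [gridCost]
    linarith
  | cooperative =>
    have h : gridCost .cooperative f N k = potential .cooperative f k := by
      have : ∀ j ∈ Finset.range N, marginal .cooperative f (j * (k / N)) (k / N) =
          potential .cooperative f ((j + 1 : ℕ) * (k / N)) -
            potential .cooperative f (j * (k / N)) := fun j _ => by
        rw [← hs]
        simp [marginal, potential]
      rw [gridCost, Finset.sum_congr rfl this,
        Finset.sum_range_sub (fun j => potential .cooperative f (j * (k / N))), hc]
      simp [potential_zero]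
    rw [h]
    have : (0 : ℝ) ≤ (k : ℝ) * f k / N := by positivity
    linarith

theorem continuousOn_potential (hf : Admissible kind f) {a : ℝ} (ha : 0 < a) :
    ContinuousOn (fun x : ℝ => potential kind f x.toNNReal) (Set.Ici a) := by
  cases kind with
  | selfish =>
    have h : Continuous fun x : ℝ => ∫ t in (0 : ℝ)..x, (f t.toNNReal : ℝ) :=
      intervalIntegral.continuous_primitive (fun a b => f.intervalIntegrable a b) 0
    refine h.continuousOn.congr fun x hx => ?_
    have hx' : 0 ≤ x := ha.le.trans hx
    simp [potential, Real.coe_toNNReal x hx']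
  | cooperative =>
    have h := (hf rfl).continuousOn_interior
    rw [interior_Ici] at h
    refine (h.mono fun x hx => lt_of_lt_of_le ha hx).congr fun x hx => ?_
    have hx' : 0 ≤ x := ha.le.trans hx
    simp [potential, Real.coe_toNNReal x hx']

/-- The potential takes every value above `potential kind f k` at some larger load. -/
theorem exists_potential_eq (hf : Admissible kind f) {k : ℝ≥0} (hk : 0 < k) {y : ℝ}
    (hy : potential kind f k ≤ y) : ∃ k', k ≤ k' ∧ potential kind f k' = y := by
  have hfk := f.pos_real hk
  set b : ℝ≥0 := k + (|y| / f k).toNNReal with hb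
  have hkb : k ≤ b := le_self_add
  have hyb : y ≤ potential kind f b := by
    have h1 := le_potential kind f hkb
    have h2 : ((b : ℝ) - k) * f k = |y| := by
      rw [hb, NNReal.coe_add, Real.coe_toNNReal _ (by positivity)]
      field_simp
      ring
    rw [h2] at h1
    exact (le_abs_self y).trans h1
  have hcont := (continuousOn_potential hf (NNReal.coe_pos.2 hk)).mono
    (Set.Icc_subset_Ici_self : Set.Icc (k : ℝ) b ⊆ _)
  obtain ⟨x, hx, hxy⟩ := intermediate_value_Icc (NNReal.coe_le_coe.2 hkb) hcont
    (show y ∈ Set.Icc _ _ by simpa using ⟨hy, hyb⟩)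
  exact ⟨x.toNNReal, by simpa using Real.toNNReal_mono hx.1, hxy⟩

end Marginal

/-! ### The upper bound -/

namespace CongestionGame

variable {G : CongestionGame}

theorem congestion_eq (σ : G.Assignment) (e : G.Resource) :
    G.congestion σ e = ∑ i, if e ∈ σ i then G.weight i else 0 := by
  rw [congestion, Finset.sum_filter]

theorem social_eq (σ : G.Assignment) :
    G.social σ = ∑ e, (G.congestion σ e : ℝ) * G.latency e (G.congestion σ e) := by
  have h : ∀ i, (G.weight i : ℝ) * G.cost i σ = ∑ e, (if e ∈ σ i then (G.weight i : ℝ) else 0) *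
      G.latency e (G.congestion σ e) := fun i => by
    rw [cost, Finset.mul_sum, ← Finset.sum_filter_add_sum_filter_not Finset.univ (· ∈ σ i)]
    rw [Finset.sum_congr (g := fun e => (G.weight i : ℝ) * G.latency e (G.congestion σ e))
      (s₁ := Finset.univ.filter (· ∈ σ i)) rfl (fun e he => by
        rw [if_pos (Finset.mem_filter.1 he).2])]
    rw [Finset.sum_eq_zero (s := Finset.univ.filter (¬ · ∈ σ i)) (fun e he => by
        rw [if_neg (Finset.mem_filter.1 he).2, zero_mul]), add_zero]
    congr 1
    ext e
    simp
  rw [social, Finset.sum_congr rfl fun i _ => h i, Finset.sum_comm]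
  refine Finset.sum_congr rfl fun e _ => ?_
  rw [← Finset.sum_mul]
  congr 1
  rw [congestion_eq, NNReal.coe_sum]
  exact Finset.sum_congr rfl fun i _ => by split_ifs <;> rfl

theorem social_nonneg (σ : G.Assignment) : 0 ≤ G.social σ := by
  rw [social_eq]
  exact Finset.sum_nonneg fun e _ => by positivity

theorem congestion_update {τ : G.Assignment} {i : G.Player} (hi : τ i = ∅)
    (S : Finset G.Resource) (e : G.Resource) :
    G.congestion (Function.update τ i S) e =
      G.congestion τ e + if e ∈ S then G.weight i else 0 := by
  have h : ∀ j, (if e ∈ Function.update τ i S j then G.weight j else 0) =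
      (if e ∈ τ j then G.weight j else 0) +
        if j = i then (if e ∈ S then G.weight i else 0) else 0 := fun j => by
    by_cases hj : j = i
    · subst hj
      simp [hi]
    · simp [hj]
  rw [congestion_eq, congestion_eq, Finset.sum_congr rfl fun j _ => h j,
    Finset.sum_add_distrib, Finset.sum_ite_eq' Finset.univ i]
  simp

theorem weight_mul_cost_update {τ : G.Assignment} {i : G.Player} (hi : τ i = ∅)
    (S : Finset G.Resource) :
    (G.weight i : ℝ) * G.cost i (Function.update τ i S) =
      ∑ e ∈ S, marginal .selfish (G.latency e) (G.congestion τ e) (G.weight i) := by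
  rw [cost, Finset.mul_sum, Function.update_self]
  refine Finset.sum_congr rfl fun e he => ?_
  rw [congestion_update hi, if_pos he]
  rfl

theorem social_update_sub {τ : G.Assignment} {i : G.Player} (hi : τ i = ∅)
    (S : Finset G.Resource) :
    G.social (Function.update τ i S) - G.social τ =
      ∑ e ∈ S, marginal .cooperative (G.latency e) (G.congestion τ e) (G.weight i) := by
  rw [social_eq, social_eq, ← Finset.sum_sub_distrib]
  symm
  refine Finset.sum_subset_zero_on_sdiff (Finset.subset_univ S) (fun e he => ?_) (fun e he => ?_)
  · rw [congestion_update hi, if_neg (Finset.mem_sdiff.1 he).2, add_zero, sub_self]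
  · rw [congestion_update hi, if_pos he]
    simp [marginal]

/-- In terms of marginal costs, the walk condition reads the same for both kinds of players. -/
theorem arrivalCost_le_iff (kind : PlayerKind) {ε : ℝ} {τ : G.Assignment} {i : G.Player}
    (hi : τ i = ∅) (hw : 0 < G.weight i) (S T : Finset G.Resource) :
    G.arrivalCost kind τ i T ≤ (1 + ε) * G.arrivalCost kind τ i S ↔
      ∑ e ∈ T, marginal kind (G.latency e) (G.congestion τ e) (G.weight i) ≤
        (1 + ε) * ∑ e ∈ S, marginal kind (G.latency e) (G.congestion τ e) (G.weight i) := by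
  cases kind with
  | selfish =>
    rw [← weight_mul_cost_update hi, ← weight_mul_cost_update hi, mul_left_comm]
    exact (mul_le_mul_iff_right₀ (NNReal.coe_pos.2 hw)).symm
  | cooperative =>
    rw [← social_update_sub hi, ← social_update_sub hi]
    rfl

theorem IsOneRoundWalk.sum_marginal_le {kind : PlayerKind} {ε : ℝ} {π : G.ArrivalOrder}
    {σ : G.Assignment} (h : G.IsOneRoundWalk kind ε π σ) (i : G.Player)
    {S : Finset G.Resource} (hS : S ∈ G.strategies i) :
    ∑ e ∈ σ i, marginal kind (G.latency e) (G.congestion (G.partialState π σ (π i)) e)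
        (G.weight i) ≤
      (1 + ε) * ∑ e ∈ S, marginal kind (G.latency e)
        (G.congestion (G.partialState π σ (π i)) e) (G.weight i) := by
  rcases eq_or_lt_of_le (zero_le (a := G.weight i)) with h0 | h0
  · simp [← h0, marginal_zero]
  · exact (arrivalCost_le_iff kind (by simp [partialState]) h0 S (σ i)).1 (h.2 i S hS)

theorem update_partialState (π : G.ArrivalOrder) (σ : G.Assignment) (i : G.Player) :
    Function.update (G.partialState π σ (π i)) i (σ i) = G.partialState π σ (π i + 1) := by
  funext j
  by_cases hj : j = i
  · subst hj
    simp [partialState]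
  · have h : (π j : ℕ) ≠ π i := fun h => hj (π.injective (Fin.ext h))
    simp only [Function.update_of_ne hj, partialState]
    congr 1
    exact propext ⟨fun h => by omega, fun h' => by omega⟩

theorem congestion_partialState_succ (π : G.ArrivalOrder) (σ : G.Assignment) (i : G.Player)
    (e : G.Resource) :
    G.congestion (G.partialState π σ (π i + 1)) e =
      G.congestion (G.partialState π σ (π i)) e + if e ∈ σ i then G.weight i else 0 := by
  rw [← update_partialState, congestion_update (by simp [partialState])]

theorem congestion_partialState_le (π : G.ArrivalOrder) (σ : G.Assignment) (t : ℕ)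
    (e : G.Resource) : G.congestion (G.partialState π σ t) e ≤ G.congestion σ e := by
  rw [congestion_eq, congestion_eq]
  refine Finset.sum_le_sum fun i _ => ?_
  by_cases h : (π i : ℕ) < t <;> simp [partialState, h]

/-- The total marginal cost of a walk is at least the total potential of its final profile. -/
theorem sum_potential_le (kind : PlayerKind) (π : G.ArrivalOrder) (σ : G.Assignment) :
    ∑ e, potential kind (G.latency e) (G.congestion σ e) ≤
      ∑ i, ∑ e ∈ σ i, marginal kind (G.latency e)
        (G.congestion (G.partialState π σ (π i)) e) (G.weight i) := by
  have hswap : ∑ i, ∑ e ∈ σ i, marginal kind (G.latency e)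
        (G.congestion (G.partialState π σ (π i)) e) (G.weight i) =
      ∑ e, ∑ i with e ∈ σ i, marginal kind (G.latency e)
        (G.congestion (G.partialState π σ (π i)) e) (G.weight i) :=
    Finset.sum_comm' (by simp)
  rw [hswap]
  refine Finset.sum_le_sum fun e _ => ?_
  set F : ℕ → ℝ := fun t =>
    potential kind (G.latency e) (G.congestion (G.partialState π σ t) e) with hF
  have h0 : F 0 = 0 := by simp [hF, partialState, congestion, potential_zero]
  have hn : F (Fintype.card G.Player) = potential kind (G.latency e) (G.congestion σ e) := by
    have : G.partialState π σ (Fintype.card G.Player) = σ :=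
      funext fun i => if_pos (π i).is_lt
    simp only [hF, this]
  have hstep : ∀ i, F (π i + 1) - F (π i) ≤ if e ∈ σ i then marginal kind (G.latency e)
      (G.congestion (G.partialState π σ (π i)) e) (G.weight i) else 0 := fun i => by
    simp only [hF]
    rw [congestion_partialState_succ]
    split_ifs with he
    · exact potential_add_sub_le _ _ _ _
    · simp
  have hsum : ∑ i, (F (π i + 1) - F (π i)) = F (Fintype.card G.Player) - F 0 := by
    rw [← Finset.sum_range_sub, ← Fin.sum_univ_eq_sum_range (fun t => F (t + 1) - F t)]
    exact Equiv.sum_comp π (fun t => F (t + 1) - F t)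
  rw [← hn, Finset.sum_filter]
  have := Finset.sum_le_sum fun i (_ : i ∈ Finset.univ) => hstep i
  rw [hsum, h0, sub_zero] at this
  exact this

/-- Entering along `ρ` during the walk costs at most what entering on top of the final profile,
with all players of `ρ` on a resource merged into one, would cost. -/
theorem sum_marginal_le_merged {kind : PlayerKind}
    (hG : ∀ e, Admissible kind (G.latency e)) (π : G.ArrivalOrder) (σ ρ : G.Assignment) :
    ∑ i, ∑ e ∈ ρ i, marginal kind (G.latency e)
        (G.congestion (G.partialState π σ (π i)) e) (G.weight i) ≤
      ∑ e, marginal kind (G.latency e) (G.congestion σ e) (G.congestion ρ e) := by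
  have hswap : ∑ i, ∑ e ∈ ρ i, marginal kind (G.latency e)
        (G.congestion (G.partialState π σ (π i)) e) (G.weight i) =
      ∑ e, ∑ i with e ∈ ρ i, marginal kind (G.latency e)
        (G.congestion (G.partialState π σ (π i)) e) (G.weight i) :=
    Finset.sum_comm' (by simp)
  rw [hswap]
  refine Finset.sum_le_sum fun e _ => ?_
  exact (Finset.sum_le_sum fun i _ =>
    marginal_mono (hG e) (congestion_partialState_le π σ (π i) e) (G.weight i)).trans
    (CongestionGames.sum_marginal_le (hG e) _ _ _)

theorem IsOneRoundWalk.sum_betaW_nonneg {kind : PlayerKind} {ε : ℝ} (hε : 0 ≤ ε)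
    (hG : ∀ e, Admissible kind (G.latency e)) {π : G.ArrivalOrder} {σ ρ : G.Assignment}
    (h : G.IsOneRoundWalk kind ε π σ) (hρ : G.IsProfile ρ) :
    0 ≤ ∑ e, betaW kind ε (G.congestion σ e) (G.congestion ρ e) (G.latency e) := by
  have h1 := sum_potential_le kind π σ
  have h2 := sum_marginal_le_merged hG π σ ρ
  have h3 := Finset.sum_le_sum fun i (_ : i ∈ Finset.univ) => h.sum_marginal_le i (hρ i)
  rw [← Finset.mul_sum] at h3
  have h4 := mul_le_mul_of_nonneg_left h2 (by linarith : 0 ≤ 1 + ε)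
  simp only [betaW_eq, Finset.sum_add_distrib, Finset.sum_neg_distrib, ← Finset.mul_sum]
  linarith

end CongestionGame

theorem le_of_forall_sub_mul_le {a b c : ℝ} (hc : 0 ≤ c)
    (h : ∀ k : ℝ≥0, 0 < k → k ≤ 1 → a - c * k ≤ b) : a ≤ b := by
  refine le_of_forall_pos_le_add fun δ hδ => ?_
  have hpos : 0 < δ / (c + 1) := by positivity
  set k : ℝ≥0 := min 1 (δ / (c + 1)).toNNReal with hk
  have h1 := h k (lt_min one_pos (Real.toNNReal_pos.2 hpos)) (min_le_left _ _)
  have h2 : (k : ℝ) ≤ δ / (c + 1) := by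
    have : k ≤ (δ / (c + 1)).toNNReal := min_le_right _ _
    rw [← Real.coe_toNNReal _ hpos.le]
    exact this
  have h3 : c * k ≤ (c + 1) * (δ / (c + 1)) := by
    have : (0 : ℝ) ≤ k := k.2
    nlinarith
  rw [mul_div_cancel₀ _ (by positivity)] at h3
  linarith

section Bound

variable {kind : PlayerKind} {ε x Γ : ℝ} {f : Latency}

/-- A bound on `gammaWAt` for positive loads passes to the limit of vanishing loads. -/
theorem add_betaW_le_of_gammaWAt_le (hε : 0 ≤ ε) (hx : 1 ≤ x) (hf : Admissible kind f)
    (h : ∀ k o : ℝ≥0, 0 < k → 0 < o → gammaWAt kind ε x k o f ≤ Γ) (k o : ℝ≥0) :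
    (k : ℝ) * f k + x * betaW kind ε k o f ≤ Γ * ((o : ℝ) * f o) := by
  have hpos : ∀ k o : ℝ≥0, 0 < k → 0 < o →
      (k : ℝ) * f k + x * betaW kind ε k o f ≤ Γ * ((o : ℝ) * f o) := fun k o hk ho => by
    have := h k o hk ho
    rwa [gammaWAt, div_le_iff₀ (mul_pos (NNReal.coe_pos.2 ho) (f.pos_real ho))] at this
  have hf1 : (0 : ℝ) ≤ f 1 := (f 1).2
  have hxε : 0 ≤ x * (1 + ε) := by positivity
  rcases eq_or_lt_of_le (zero_le (a := k)) with rfl | hk <;>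
    rcases eq_or_lt_of_le (zero_le (a := o)) with rfl | ho
  · simp [betaW_eq, potential_zero, marginal_zero]
  · refine le_of_forall_sub_mul_le (c := x * f 1) (by positivity) fun k hk hk1 => ?_
    have h1 := hpos k o hk ho
    rw [betaW_eq] at h1 ⊢
    rw [potential_zero, NNReal.coe_zero, zero_mul, zero_add, neg_zero, zero_add, ← mul_assoc]
    rw [mul_add, ← mul_assoc] at h1
    have h2 := mul_le_mul_of_nonneg_left (marginal_mono hf (zero_le (a := k)) o) hxε
    have h3 := potential_le kind f k
    have h4 : (k : ℝ) * f k ≤ k * f 1 := mul_le_mul_of_nonneg_left (f.mono_real hk1) k.2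
    have h5 : (0 : ℝ) ≤ k * f k := by positivity
    have h6 := mul_le_mul_of_nonneg_left (h3.trans h4) (by linarith : 0 ≤ x)
    linarith
  · refine le_of_forall_sub_mul_le (c := |Γ| * f 1) (by positivity) fun o ho ho1 => ?_
    have h1 := hpos k o hk ho
    rw [betaW_eq] at h1 ⊢
    rw [marginal_zero, mul_zero, add_zero, NNReal.coe_zero, zero_mul, mul_zero]
    have h2 := mul_nonneg hxε (marginal_nonneg kind f k o)
    have h4 : (o : ℝ) * f o ≤ o * f 1 := mul_le_mul_of_nonneg_left (f.mono_real ho1) o.2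
    have h5 : (0 : ℝ) ≤ o * f o := by positivity
    have h6 : Γ * (o * f o) ≤ |Γ| * (o * f 1) :=
      mul_le_mul (le_abs_self Γ) h4 h5 (abs_nonneg _)
    linarith
  · exact hpos k o hk ho

theorem CongestionGame.competitiveRatio_le {G : CongestionGame} (hε : 0 ≤ ε) (hx : 1 ≤ x)
    (hG : ∀ e, Admissible kind (G.latency e))
    (h : ∀ e, ∀ k o : ℝ≥0, 0 < k → 0 < o → gammaWAt kind ε x k o (G.latency e) ≤ Γ) :
    G.competitiveRatio kind ε ≤ (Γ : EReal) := by
  refine iSup₂_le fun σ hσ => iSup₂_le fun ρ hρ => EReal.coe_le_coe_iff.2 ?_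
  obtain ⟨π, hπ⟩ := hσ
  have hβ := hπ.sum_betaW_nonneg hε hG hρ.1
  have hle : G.social σ ≤ Γ * G.social ρ := by
    rw [social_eq, social_eq, Finset.mul_sum]
    have := Finset.sum_le_sum fun e (_ : e ∈ Finset.univ) =>
      add_betaW_le_of_gammaWAt_le hε hx (hG e) (h e) (G.congestion σ e) (G.congestion ρ e)
    rw [Finset.sum_add_distrib, ← Finset.mul_sum] at this
    have h2 := mul_nonneg (by linarith : 0 ≤ x) hβ
    linarith
  have hΓ : 0 ≤ Γ := by
    obtain ⟨i⟩ : Nonempty G.Player :=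
      Fintype.card_pos_iff.1 (lt_of_lt_of_le two_pos G.two_le_card)
    obtain ⟨S, hS⟩ := G.strategies_nonempty i
    obtain ⟨e, -⟩ := G.nonempty_of_mem i S hS
    have h1 := add_betaW_le_of_gammaWAt_le hε hx (hG e) (h e) 0 1
    rw [betaW_eq, potential_zero, marginal_from_zero] at h1
    have h2 := (G.latency e).pos_real one_pos
    have h3 : 0 ≤ x * ((1 + ε) * (G.latency e 1 : ℝ)) := by positivity
    simp only [NNReal.coe_zero, zero_mul, neg_zero, zero_add, NNReal.coe_one, one_mul] at h1
    exact nonneg_of_mul_nonneg_left (h3.trans h1) h2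
  rcases eq_or_lt_of_le (G.social_nonneg (σ := ρ)) with h0 | h0
  · rw [← h0, div_zero]
    exact hΓ
  · rwa [div_le_iff₀ h0]

end Bound

theorem classCompetitiveRatio_le_gammaW {kind : PlayerKind} {ε : ℝ} (hε : 0 ≤ ε)
    {C : Set Latency} (hC : ∀ f ∈ C, Admissible kind f) :
    classCompetitiveRatio kind ε (weightedGames C) ≤ gammaW kind ε (weightedGames C) := by
  refine le_iInf₂ fun x hx => iSup₂_le fun G hG => ?_
  have hsup : ∀ e, ∀ k o : ℝ≥0, 0 < k → 0 < o →
      ((gammaWAt kind ε x k o (G.latency e) : ℝ) : EReal) ≤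
        ⨆ f ∈ latencyClass (weightedGames C), ⨆ k ∈ Set.Ioi (0 : ℝ≥0),
          ⨆ o ∈ Set.Ioi (0 : ℝ≥0), ((gammaWAt kind ε x k o f : ℝ) : EReal) :=
    fun e k o hk ho => by
      refine le_iSup₂_of_le (G.latency e) ⟨G, hG, e, rfl⟩ ?_
      exact le_iSup₂_of_le k hk (le_iSup₂_of_le o ho le_rfl)
  refine EReal.le_of_forall_lt_iff_le.1 fun Γ hΓ => ?_
  exact G.competitiveRatio_le hε hx (fun e => hC _ (hG e)) fun e k o hk ho =>
    EReal.coe_le_coe_iff.1 ((hsup e k o hk ho).trans hΓ.le)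

/-! ### Schedules of load patterns -/

/-- If the half-lines on which the affine functions `x ↦ a i + x * b i` are positive cover
`[1, ∞)`, then one with non-negative slope is positive at `1`, or an increasing
and a decreasing one are positive at a common point. -/
theorem exists_nonneg_slope_or_opposite_slopes {ι : Type*} (a b : ι → ℝ)
    (h : ∀ x : ℝ, 1 ≤ x → ∃ i, 0 < a i + x * b i) (hb : ∃ i, 0 < b i) :
    (∃ i, 0 ≤ b i ∧ 0 < a i + b i) ∨
      ∃ x : ℝ, 1 ≤ x ∧ ∃ i j, 0 < b i ∧ b j < 0 ∧ 0 < a i + x * b i ∧ 0 < a j + x * b j := by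
  by_contra! hcon
  obtain ⟨hI, hII⟩ := hcon
  set P : Set ℝ := {x | 1 ≤ x ∧ ∃ i, 0 < b i ∧ 0 < a i + x * b i} with hP
  have hPne : P.Nonempty := by
    obtain ⟨i, hi⟩ := hb
    refine ⟨max 1 ((1 - a i) / b i), le_max_left _ _, i, hi, ?_⟩
    have := mul_le_mul_of_nonneg_right (le_max_right 1 ((1 - a i) / b i)) hi.le
    rw [div_mul_cancel₀ _ hi.ne'] at this
    linarith
  have hPbdd : BddBelow P := ⟨1, fun x hx => hx.1⟩
  have h1 : 1 ≤ sInf P := le_csInf hPne fun x hx => hx.1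
  obtain ⟨j, hj⟩ := h _ h1
  have hbj : b j < 0 := by
    by_contra! hbj
    rcases eq_or_lt_of_le hbj with hbj | hbj
    · have := hI j hbj.le
      rw [← hbj] at hj this
      linarith
    · have h2 := hI j hbj.le
      have hlt : 1 < sInf P := by
        rcases eq_or_lt_of_le h1 with he | hlt
        · rw [← he] at hj
          linarith
        · exact hlt
      -- a function with positive slope that is positive at `sInf P` is so slightly to the left,
      -- which puts a point of `P` below its infimum
      set y := max 1 (sInf P - (a j + sInf P * b j) / (2 * b j)) with hy
      have hylt : y < sInf P := max_lt hlt (by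
        have : 0 < (a j + sInf P * b j) / (2 * b j) := by positivity
        linarith)
      refine absurd (csInf_le hPbdd (a := y) ⟨le_max_left _ _, j, hbj, ?_⟩) (not_le.2 hylt)
      have h3 := mul_le_mul_of_nonneg_right
        (le_max_right 1 (sInf P - (a j + sInf P * b j) / (2 * b j))) hbj.le
      have h4 : (sInf P - (a j + sInf P * b j) / (2 * b j)) * b j =
        sInf P * b j - (a j + sInf P * b j) / 2 := by field_simp
      rw [h4] at h3
      linarith
  have hlt : sInf P < sInf P + (a j + sInf P * b j) / (2 * -b j) := by
    have : 0 < (a j + sInf P * b j) / (2 * -b j) := div_pos hj (by linarith)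
    linarith
  obtain ⟨y, ⟨hy1, i, hi, hyi⟩, hy⟩ := exists_lt_of_csInf_lt hPne hlt
  have h3 := hII y hy1 i j hi hbj hyi
  have h4 := mul_lt_mul_of_neg_right hy hbj
  have h5 : (sInf P + (a j + sInf P * b j) / (2 * -b j)) * b j =
      sInf P * b j - (a j + sInf P * b j) / 2 := by
    have := hbj.ne
    field_simp
    ring
  rw [h5] at h4
  linarith

/-- A latency function `f` together with positive loads: the load `k` produced by the walk and the
load `o` produced by the optimum. -/
structure LoadPattern where
  f : Latency
  k : ℝ≥0
  o : ℝ≥0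
  k_pos : 0 < k
  o_pos : 0 < o

namespace LoadPattern

variable (τ : LoadPattern) {kind : PlayerKind} {ε : ℝ}

/-- The social cost of the walk on a resource with load pattern `τ`. -/
def walkCost : ℝ := (τ.k : ℝ) * τ.f τ.k

/-- The social cost of the optimum on a resource with load pattern `τ`. -/
def optCost : ℝ := (τ.o : ℝ) * τ.f τ.o

/-- The largest marginal cost elsewhere that an arriving player of weight `o` accepts instead of
entering the resource at load `k`. -/
def threshold (kind : PlayerKind) (ε : ℝ) : ℝ := (1 + ε) * marginal kind τ.f τ.k τ.o

theorem walkCost_pos : 0 < τ.walkCost := mul_pos (NNReal.coe_pos.2 τ.k_pos) (τ.f.pos_real τ.k_pos)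

theorem optCost_pos : 0 < τ.optCost := mul_pos (NNReal.coe_pos.2 τ.o_pos) (τ.f.pos_real τ.o_pos)

theorem threshold_pos (kind : PlayerKind) (hε : 0 ≤ ε) : 0 < τ.threshold kind ε :=
  mul_pos (by linarith) (marginal_pos _ _ _ τ.o_pos)

theorem betaW_eq_threshold_sub :
    betaW kind ε τ.k τ.o τ.f = τ.threshold kind ε - potential kind τ.f τ.k := by
  rw [betaW_eq, threshold]
  ring

theorem lt_gammaWAt_iff {γ x : ℝ} : γ < gammaWAt kind ε x τ.k τ.o τ.f ↔
    0 < (τ.walkCost - γ * τ.optCost) + x * betaW kind ε τ.k τ.o τ.f := by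
  have h : gammaWAt kind ε x τ.k τ.o τ.f =
      (τ.walkCost + x * betaW kind ε τ.k τ.o τ.f) / τ.optCost := rfl
  rw [h, lt_div_iff₀ τ.optCost_pos]
  constructor <;> intro h <;> linarith

theorem eventually_gridCost_lt {δ : ℝ} (hδ : 0 < δ) : ∀ᶠ N : ℕ in Filter.atTop,
    gridCost kind τ.f N τ.k < potential kind τ.f τ.k + δ := by
  have h := tendsto_const_div_atTop_nhds_zero_nat ((τ.k : ℝ) * τ.f τ.k)
  filter_upwards [h.eventually_lt_const hδ, Filter.eventually_gt_atTop 0] with N hN hN0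
  have := gridCost_le kind τ.f hN0 τ.k
  linarith

theorem eventually_grid_excess_pos {γ x : ℝ}
    (h : 0 < (τ.walkCost - γ * τ.optCost) + x * betaW kind ε τ.k τ.o τ.f) (hx : 0 ≤ x) :
    ∀ᶠ N : ℕ in Filter.atTop, 0 < (τ.walkCost - γ * τ.optCost) +
      x * (τ.threshold kind ε - gridCost kind τ.f N τ.k) := by
  set d := (τ.walkCost - γ * τ.optCost) + x * betaW kind ε τ.k τ.o τ.f with hd
  filter_upwards [τ.eventually_gridCost_lt (kind := kind) (show 0 < d / (x + 1) by positivity)]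
    with N hN
  have h1 := mul_le_mul_of_nonneg_left hN.le hx
  have h2 : x * (d / (x + 1)) < d := by
    rw [← mul_div_assoc, div_lt_iff₀ (by positivity)]
    linarith
  rw [betaW_eq_threshold_sub] at hd
  linarith

/-- If `β ≥ 0`, the walk load can be raised until the budget is used up: the slack `β` turns into
walk cost. -/
theorem exists_raised (hf : Admissible kind τ.f) (hε : 0 ≤ ε) {γ : ℝ}
    (hβ : 0 ≤ betaW kind ε τ.k τ.o τ.f)
    (h : 0 < (τ.walkCost - γ * τ.optCost) + betaW kind ε τ.k τ.o τ.f) :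
    ∃ τ' : LoadPattern, τ'.f = τ.f ∧ 0 ≤ betaW kind ε τ'.k τ'.o τ'.f ∧
      0 < τ'.walkCost - γ * τ'.optCost := by
  rw [betaW_eq_threshold_sub] at hβ h
  obtain ⟨k', hk, hk'⟩ := exists_potential_eq hf τ.k_pos (sub_nonneg.1 hβ)
  refine ⟨⟨τ.f, k', τ.o, τ.k_pos.trans_le hk, τ.o_pos⟩, rfl, ?_, ?_⟩
  · rw [betaW_eq_threshold_sub, hk', sub_nonneg]
    exact mul_le_mul_of_nonneg_left (marginal_mono hf hk _) (by linarith)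
  · have h2 := sub_potential_mono kind τ.f hk
    rw [hk'] at h2
    simp only [walkCost, optCost] at h ⊢
    linarith

/-- With walk load `1` and optimal load `2` the quantity `β` is positive. -/
theorem betaW_one_two_pos (hε : 0 ≤ ε) {f : Latency} (hf : Admissible kind f) :
    0 < betaW kind ε 1 2 f := by
  have h1 : 0 < marginal kind f 1 2 := marginal_pos _ _ _ two_pos
  have h2 : potential kind f 1 < marginal kind f 1 2 := by
    refine (potential_le kind f 1).trans_lt (lt_of_lt_of_le ?_ (marginal_mono hf zero_le 2))
    rw [marginal_from_zero]
    have h3 : (f 1 : ℝ) ≤ f 2 := f.mono_real one_le_two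
    have h4 := f.pos_real one_pos
    push_cast
    linarith
  rw [betaW_eq]
  nlinarith [mul_nonneg hε h1.le]

end LoadPattern

/-- An assignment of load patterns to the levels of an `N`-ary tree, where `L s` is the total of the
thresholds of the nodes of depth `s`. By `grid_le`, these thresholds suffice to make the players on
the edges below depth `s` prefer the upper ends. By `gain`, the walk gains at least `η` per level
over `γ` times the optimum, up to a term that telescopes, and by `bound` the excess of the cost of
the last level over the telescoped term stays bounded. -/
structure Schedule (kind : PlayerKind) (ε : ℝ) (C : Set Latency) (γ : ℝ) where
  N : ℕ
  two_le : 2 ≤ N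
  pattern : ℕ → LoadPattern
  mem : ∀ s, (pattern s).f ∈ C
  L : ℕ → ℝ
  L_pos : ∀ s, 0 < L s
  grid_le : ∀ s, L s * gridCost kind (pattern s).f N (pattern s).k ≤
    L (s + 1) * (pattern s).threshold kind ε
  η : ℝ
  η_pos : 0 < η
  x : ℝ
  gain : ∀ s, η + x * (L (s + 1) - L s) ≤
    L s / (pattern s).threshold kind ε * ((pattern s).walkCost - γ * (pattern s).optCost)
  B : ℝ
  bound : ∀ s, (γ - x) * L s ≤ B

theorem gain_step {L S O w x η : ℝ} (hO : 0 < O) (hη : η ≤ L / O * (w + x * (O - S))) :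
    η + x * (L * (S / O) - L) ≤ L / O * w := by
  have : x * (L * (S / O) - L) = L / O * (x * (S - O)) := by field_simp
  rw [this]
  linarith [mul_add (L / O) w (x * (O - S)), mul_sub (L / O * x) O S,
    show L / O * (w + x * (O - S)) = L / O * w - L / O * (x * (S - O)) by ring]

section Schedules

variable {kind : PlayerKind} {ε γ : ℝ} {C : Set Latency}

/-- A single pattern with `β ≥ 0` repeats on all levels. If the grid cost exceeds the threshold,
the levels grow geometrically, but so slowly that the growth does not eat up the gain. -/
theorem Schedule.of_single (hε : 0 ≤ ε) (hγ : 0 ≤ γ) (τ : LoadPattern) (hτ : τ.f ∈ C)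
    (hβ : 0 ≤ betaW kind ε τ.k τ.o τ.f) (h : 0 < τ.walkCost - γ * τ.optCost) :
    Nonempty (Schedule kind ε C γ) := by
  have hx : 0 < (τ.walkCost - γ * τ.optCost) + γ * betaW kind ε τ.k τ.o τ.f := by positivity
  obtain ⟨N, hN, hN2⟩ := ((τ.eventually_grid_excess_pos hx hγ).and
    (Filter.eventually_ge_atTop 2)).exists
  have hO := τ.threshold_pos kind hε
  set O := τ.threshold kind ε with hOdef
  set S := gridCost kind τ.f N τ.k with hS
  rcases le_or_gt S O with hSO | hSO
  · exact ⟨{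
      N := N, two_le := hN2, pattern := fun _ => τ, mem := fun _ => hτ
      L := fun _ => 1, L_pos := fun _ => one_pos
      grid_le := fun _ => by simpa using hSO
      η := 1 / O * (τ.walkCost - γ * τ.optCost), η_pos := by positivity
      x := γ, gain := fun _ => by simp [hOdef]
      B := 0, bound := fun _ => by simp }⟩
  · have hr : 1 ≤ S / O := (one_le_div hO).2 hSO.le
    exact ⟨{
      N := N, two_le := hN2, pattern := fun _ => τ, mem := fun _ => hτ
      L := fun s => (S / O) ^ s, L_pos := fun s => pow_pos (by linarith) s
      grid_le := fun s => by
        rw [pow_succ, mul_assoc, div_mul_cancel₀ _ hO.ne']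
      η := 1 / O * (τ.walkCost - γ * τ.optCost + γ * (O - S))
      η_pos := by positivity
      x := γ
      gain := fun s => by
        rw [pow_succ]
        refine gain_step hO (mul_le_mul_of_nonneg_right ?_ hN.le)
        gcongr
        exact one_le_pow₀ hr
      B := 0, bound := fun _ => by simp }⟩

/-- The levels of a schedule that mixes two patterns: the level value is multiplied by `r₂ > 1`
while it is at most `1`, and by `r₁ < 1` otherwise. -/
noncomputable def mixedLevel (r₁ r₂ : ℝ) : ℕ → ℝ
  | 0 => 1
  | s + 1 => if mixedLevel r₁ r₂ s ≤ 1 then mixedLevel r₁ r₂ s * r₂ else mixedLevel r₁ r₂ s * r₁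

theorem mixedLevel_mem {r₁ r₂ : ℝ} (h0 : 0 < r₁) (h1 : r₁ < 1) (h2 : 1 < r₂) (s : ℕ) :
    r₁ ≤ mixedLevel r₁ r₂ s ∧ mixedLevel r₁ r₂ s ≤ r₂ := by
  induction s with
  | zero => exact ⟨h1.le, h2.le⟩
  | succ s ih =>
    rw [mixedLevel]
    split_ifs with h
    · constructor <;> nlinarith
    · constructor <;> nlinarith

/-- Two patterns with `β` of opposite signs, both profitable at the same `x`, are mixed so that the
level values stay bounded. -/
theorem Schedule.of_pair (hε : 0 ≤ ε) {x : ℝ} (hx : 0 ≤ x) (τ₁ τ₂ : LoadPattern)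
    (hτ₁ : τ₁.f ∈ C) (hτ₂ : τ₂.f ∈ C)
    (hβ₁ : 0 < betaW kind ε τ₁.k τ₁.o τ₁.f) (hβ₂ : betaW kind ε τ₂.k τ₂.o τ₂.f < 0)
    (h₁ : 0 < (τ₁.walkCost - γ * τ₁.optCost) + x * betaW kind ε τ₁.k τ₁.o τ₁.f)
    (h₂ : 0 < (τ₂.walkCost - γ * τ₂.optCost) + x * betaW kind ε τ₂.k τ₂.o τ₂.f) :
    Nonempty (Schedule kind ε C γ) := by
  obtain ⟨N, ⟨⟨hN₁, hN₂⟩, hN1⟩, hN⟩ := ((((τ₁.eventually_grid_excess_pos h₁ hx).and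
    (τ₂.eventually_grid_excess_pos h₂ hx)).and (τ₁.eventually_gridCost_lt hβ₁)).and
    (Filter.eventually_ge_atTop 2)).exists
  have hO₁ := τ₁.threshold_pos kind hε
  have hO₂ := τ₂.threshold_pos kind hε
  rw [τ₁.betaW_eq_threshold_sub, add_sub_cancel] at hN1
  rw [τ₂.betaW_eq_threshold_sub, sub_neg] at hβ₂
  have hN0 : 0 < N := by omega
  have hN2 := hβ₂.trans_le (potential_le_gridCost kind τ₂.f hN0 τ₂.k)
  have hS₁ : 0 < gridCost kind τ₁.f N τ₁.k :=
    Finset.sum_pos (fun j _ => marginal_pos _ _ _ (div_pos τ₁.k_pos (by exact_mod_cast hN0)))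
      ⟨0, Finset.mem_range.2 hN0⟩
  set O₁ := τ₁.threshold kind ε with hO₁d
  set O₂ := τ₂.threshold kind ε with hO₂d
  set S₁ := gridCost kind τ₁.f N τ₁.k with hS₁d
  set S₂ := gridCost kind τ₂.f N τ₂.k with hS₂d
  set e₁ := (τ₁.walkCost - γ * τ₁.optCost) + x * (O₁ - S₁) with he₁
  set e₂ := (τ₂.walkCost - γ * τ₂.optCost) + x * (O₂ - S₂) with he₂
  have hr0 : 0 < S₁ / O₁ := by positivity
  have hr1 : S₁ / O₁ < 1 := (div_lt_one hO₁).2 hN1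
  have hr2 : 1 < S₂ / O₂ := (one_lt_div hO₂).2 hN2
  have hmem := mixedLevel_mem hr0 hr1 hr2
  set L := mixedLevel (S₁ / O₁) (S₂ / O₂) with hL
  have hsucc : ∀ s, L (s + 1) = if L s ≤ 1 then L s * (S₂ / O₂) else L s * (S₁ / O₁) :=
    fun s => rfl
  have hLpos : ∀ s, 0 < L s := fun s => hr0.trans_le (hmem s).1
  refine ⟨{
    N := N, two_le := hN, pattern := fun s => if L s ≤ 1 then τ₂ else τ₁
    mem := fun s => by split_ifs <;> assumption
    L := L, L_pos := hLpos
    grid_le := fun s => by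
      rw [hsucc]
      split_ifs
      · rw [mul_assoc, ← hO₂d, div_mul_cancel₀ _ hO₂.ne']
      · rw [mul_assoc, ← hO₁d, div_mul_cancel₀ _ hO₁.ne']
    η := min (S₁ / O₁ / O₁ * e₁) (S₁ / O₁ / O₂ * e₂)
    η_pos := lt_min (by positivity) (by positivity)
    x := x
    gain := fun s => by
      rw [hsucc]
      split_ifs
      · refine gain_step hO₂ ((min_le_right _ _).trans (mul_le_mul_of_nonneg_right ?_ hN₂.le))
        exact div_le_div_of_nonneg_right (hmem s).1 hO₂.le
      · refine gain_step hO₁ ((min_le_left _ _).trans (mul_le_mul_of_nonneg_right ?_ hN₁.le))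
        exact div_le_div_of_nonneg_right (hmem s).1 hO₁.le
    B := |γ - x| * (S₂ / O₂)
    bound := fun s => mul_le_mul (le_abs_self _) (hmem s).2 (hLpos s).le (abs_nonneg _) }⟩

/-- Every non-negative real below the value of `γ_W` admits a schedule. -/
theorem Schedule.exists_of_lt (hε : 0 ≤ ε) (hC : ∀ f ∈ C, Admissible kind f) (hγ : 0 ≤ γ)
    (h : ∀ x : ℝ, 1 ≤ x → ∃ τ : LoadPattern, τ.f ∈ C ∧ γ < gammaWAt kind ε x τ.k τ.o τ.f) :
    Nonempty (Schedule kind ε C γ) := by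
  let a : {τ : LoadPattern // τ.f ∈ C} → ℝ := fun τ => τ.1.walkCost - γ * τ.1.optCost
  let b : {τ : LoadPattern // τ.f ∈ C} → ℝ := fun τ => betaW kind ε τ.1.k τ.1.o τ.1.f
  have h' : ∀ x : ℝ, 1 ≤ x → ∃ τ, 0 < a τ + x * b τ := fun x hx => by
    obtain ⟨τ, hτ, hlt⟩ := h x hx
    exact ⟨⟨τ, hτ⟩, τ.lt_gammaWAt_iff.1 hlt⟩
  have hb : ∃ τ, 0 < b τ := by
    obtain ⟨τ, hτ, -⟩ := h 1 le_rfl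
    exact ⟨⟨⟨τ.f, 1, 2, one_pos, two_pos⟩, hτ⟩,
      LoadPattern.betaW_one_two_pos hε (hC _ hτ)⟩
  rcases exists_nonneg_slope_or_opposite_slopes a b h' hb with
    ⟨τ, hbτ, hτ⟩ | ⟨x, hx, τ₁, τ₂, hb₁, hb₂, h₁, h₂⟩
  · obtain ⟨τ', hf, hβ, hpos⟩ := τ.1.exists_raised (hC _ τ.2) hε hbτ hτ
    exact Schedule.of_single hε hγ τ' (hf ▸ τ.2) hβ hpos
  · exact Schedule.of_pair hε (zero_le_one.trans hx) τ₁.1 τ₂.1 τ₁.2 τ₂.2 hb₁ hb₂ h₁ h₂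

end Schedules

/-! ### Games with two choices per player -/

theorem exists_equiv_fin_of_rank {P : Type*} [Fintype P] (rank : P → ℕ) :
    ∃ π : P ≃ Fin (Fintype.card P), ∀ p q, rank p < rank q → π p < π q := by
  let e := Fintype.equivFin P
  let key : P → ℕ ×ₗ Fin (Fintype.card P) := fun p => toLex (rank p, e p)
  have hkey : Function.Injective key := fun p q h =>
    e.injective (congrArg (fun x => (ofLex x).2) h)
  let _ : LinearOrder P := LinearOrder.lift' key hkey
  let φ := Fintype.orderIsoFinOfCardEq P rfl
  refine ⟨φ.symm.toEquiv, fun p q h => φ.symm.lt_iff_lt.2 ?_⟩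
  change key p < key q
  exact Prod.Lex.toLex_lt_toLex.2 (Or.inl h)

section TwoChoice

variable {P R : Type} [Fintype P] [DecidableEq P] [Fintype R] [DecidableEq R]

/-- The load balancing game in which player `p` chooses between the resources `g p` and `o p`. -/
abbrev twoChoiceGame (hP : 2 ≤ Fintype.card P) (lat : R → Latency) (w : P → ℝ≥0)
    (g o : P → R) : CongestionGame where
  Player := P
  Resource := R
  two_le_card := hP
  latency := lat
  weight := w
  strategies p := {{g p}, {o p}}
  strategies_nonempty p := ⟨{g p}, Or.inl rfl⟩
  nonempty_of_mem p S hS := by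
    rcases hS with rfl | rfl <;> exact Finset.singleton_nonempty _

/-- If everyone choosing `g` is a walk, and on the other hand the choices `o` never collide, then
the competitive ratio is at least the ratio of the two social costs. -/
theorem le_classCompetitiveRatio_of_twoChoice {kind : PlayerKind} {ε γ : ℝ} {C : Set Latency}
    (hε : 0 ≤ ε) (hγ : 0 ≤ γ) (hP : 2 ≤ Fintype.card P) (lat : R → Latency)
    (hlat : ∀ r, lat r ∈ C) (w : P → ℝ≥0) (hw : ∀ p, 0 < w p) (g o : P → R)
    (ho : Function.Injective o) (π : P ≃ Fin (Fintype.card P))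
    (hwalk : ∀ p,
      marginal kind (lat (g p)) (∑ q with π q < π p ∧ g q = g p, w q) (w p) ≤
        (1 + ε) * marginal kind (lat (o p)) (∑ q with π q < π p ∧ g q = o p, w q) (w p))
    (hratio : γ * ∑ p, (w p : ℝ) * lat (o p) (w p) ≤
      ∑ p, (w p : ℝ) * lat (g p) (∑ q with g q = g p, w q)) :
    (γ : EReal) ≤ classCompetitiveRatio kind ε (weightedLoadBalancingGames C) := by
  let G := twoChoiceGame hP lat w g o
  let σ : G.Assignment := fun p => {g p}
  let ρ : G.Assignment := fun p => {o p}
  have hG : G ∈ weightedLoadBalancingGames C := by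
    refine ⟨hlat, fun p S hS => ?_⟩
    rcases hS with rfl | rfl <;> exact Finset.card_singleton _
  have hσ : G.IsProfile σ := fun p => Or.inl rfl
  have hρ : G.IsProfile ρ := fun p => Or.inr rfl
  have hcong : ∀ p r, G.congestion (G.partialState π σ (π p)) r =
      ∑ q with π q < π p ∧ g q = r, w q := fun p r => by
    have : ∀ q, r ∈ G.partialState π σ (π p) q ↔ π q < π p ∧ g q = r := fun q => by
      rw [Fin.lt_def]
      by_cases h : (π q : ℕ) < π p
      · simp only [CongestionGame.partialState, h, true_and]
        exact Finset.mem_singleton.trans eq_comm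
      · simp [CongestionGame.partialState, h]
    simp only [CongestionGame.congestion, this]
    rfl
  have hwalkσ : G.IsOneRoundWalk kind ε π σ := by
    refine ⟨hσ, fun p S hS => ?_⟩
    rw [CongestionGame.arrivalCost_le_iff kind (by simp [CongestionGame.partialState]) (hw p)]
    simp only [hcong]
    rcases hS with rfl | rfl
    · refine le_mul_of_one_le_left (Finset.sum_nonneg fun _ _ => marginal_nonneg _ _ _ _) ?_
      linarith
    · rw [Finset.sum_singleton, Finset.sum_singleton]
      exact hwalk p
  have hcongσ : ∀ r, G.congestion σ r = ∑ q with g q = r, w q := fun r => by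
    have : ∀ q, r ∈ σ q ↔ g q = r := fun q => Finset.mem_singleton.trans eq_comm
    simp only [CongestionGame.congestion, this]
    rfl
  have hcongρ : ∀ p, G.congestion ρ (o p) = w p := fun p => by
    have : ∀ q, o p ∈ ρ q ↔ q = p := fun q =>
      Finset.mem_singleton.trans (eq_comm.trans ho.eq_iff)
    simp only [CongestionGame.congestion, this]
    rw [Finset.filter_eq', if_pos (Finset.mem_univ _), Finset.sum_singleton]
  have hsσ : G.social σ = ∑ p, (w p : ℝ) * lat (g p) (∑ q with g q = g p, w q) := by
    refine Finset.sum_congr rfl fun p _ => ?_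
    rw [CongestionGame.cost, Finset.sum_singleton, hcongσ]
  have hsρ : G.social ρ = ∑ p, (w p : ℝ) * lat (o p) (w p) := by
    refine Finset.sum_congr rfl fun p _ => ?_
    rw [CongestionGame.cost, Finset.sum_singleton, hcongρ]
  obtain ⟨τ, hτ, hmin⟩ := Set.exists_min_image {τ : G.Assignment | G.IsProfile τ} G.social
    (Set.toFinite _) ⟨ρ, hρ⟩
  -- every player has positive weight and pays at least the latency of her own weight
  have hpos : 0 < G.social τ := by
    have : Nonempty P := Fintype.card_pos_iff.1 (lt_of_lt_of_le two_pos hP)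
    refine Finset.sum_pos (fun p _ => mul_pos (NNReal.coe_pos.2 (hw p)) ?_)
      Finset.univ_nonempty
    refine Finset.sum_pos (fun r hr => (lat r).pos_real ?_) (G.nonempty_of_mem p _ (hτ p))
    exact (hw p).trans_le (Finset.single_le_sum (f := w) (fun _ _ => zero_le)
      (Finset.mem_filter.2 ⟨Finset.mem_univ _, hr⟩))
  have hle : γ ≤ G.social σ / G.social τ := by
    rw [le_div_iff₀ hpos, hsσ]
    refine (mul_le_mul_of_nonneg_left (hmin ρ hρ) hγ).trans ?_
    rw [hsρ]
    exact hratio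
  refine (EReal.coe_le_coe_iff.2 hle).trans ?_
  refine le_iSup₂_of_le G hG (le_iSup₂_of_le σ ⟨π, hwalkσ⟩ ?_)
  exact le_iSup₂_of_le τ ⟨hτ, fun τ' h => hmin τ' h⟩ le_rfl

end TwoChoice

/-! ### The tree game -/

/-- The nodes of depth `s` of the `N`-ary tree. A node is the list of the edges leading to it, the
last edge first, so that the children of `v` are the lists `j :: v`. -/
def levelNodes (N : ℕ) : ℕ → Finset (List (Fin N))
  | 0 => {[]}
  | s + 1 => (levelNodes N s ×ˢ Finset.univ).image fun p => p.2 :: p.1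

theorem mem_levelNodes {N s : ℕ} {v : List (Fin N)} : v ∈ levelNodes N s ↔ v.length = s := by
  induction s generalizing v with
  | zero => simp [levelNodes]
  | succ s ih => cases v <;> simp [levelNodes, ih]

theorem sum_levelNodes_succ {N : ℕ} (s : ℕ) (F : List (Fin N) → ℝ) :
    ∑ v ∈ levelNodes N (s + 1), F v = ∑ v ∈ levelNodes N s, ∑ j, F (j :: v) := by
  rw [levelNodes, Finset.sum_image, Finset.sum_product]
  rintro ⟨v, j⟩ - ⟨v', j'⟩ - h
  obtain ⟨rfl, rfl⟩ := List.cons.inj h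
  rfl

/-- The nodes of depth less than `m` of the `N`-ary tree. -/
def nodesBelow (N m : ℕ) : Finset (List (Fin N)) := (Finset.range m).biUnion (levelNodes N)

theorem mem_nodesBelow {N m : ℕ} {v : List (Fin N)} : v ∈ nodesBelow N m ↔ v.length < m := by
  simp [nodesBelow, mem_levelNodes]

theorem sum_nodesBelow {N : ℕ} (m : ℕ) (F : List (Fin N) → ℝ) :
    ∑ v ∈ nodesBelow N m, F v = ∑ s ∈ Finset.range m, ∑ v ∈ levelNodes N s, F v := by
  rw [nodesBelow, Finset.sum_biUnion]
  intro s _ t _ hst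
  refine Finset.disjoint_left.2 fun v hs ht => hst ?_
  rw [← mem_levelNodes.1 hs, mem_levelNodes.1 ht]

namespace Schedule

variable {kind : PlayerKind} {ε γ : ℝ} {C : Set Latency} (T : Schedule kind ε C γ)

theorem N_pos : 0 < T.N := two_pos.trans_le T.two_le

theorem natCast_N_pos : (0 : ℝ≥0) < T.N := by exact_mod_cast T.N_pos

/-- The weight of each of the `N` players who load a resource of the `s`-th pattern. -/
noncomputable def share (s : ℕ) : ℝ≥0 := (T.pattern s).k / T.N

theorem share_pos (s : ℕ) : 0 < T.share s := div_pos (T.pattern s).k_pos T.natCast_N_pos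

theorem N_mul_share (s : ℕ) : (T.N : ℝ≥0) * T.share s = (T.pattern s).k :=
  mul_div_cancel₀ _ T.natCast_N_pos.ne'

/-- The unit in which loads are measured on the nodes of depth `s`: it makes the weight of the
optimal player of a child equal to a share of the walk load of its parent. -/
noncomputable def unit : ℕ → ℝ≥0
  | 0 => 1
  | s + 1 => unit s * T.share s / (T.pattern (s + 1)).o

theorem unit_pos (s : ℕ) : 0 < T.unit s := by
  induction s with
  | zero => exact one_pos
  | succ s ih => exact div_pos (mul_pos ih (T.share_pos s)) (T.pattern (s + 1)).o_pos

theorem unit_succ_mul (s : ℕ) :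
    T.unit (s + 1) * (T.pattern (s + 1)).o = T.unit s * T.share s :=
  div_mul_cancel₀ _ (T.pattern (s + 1)).o_pos.ne'

/-- The marginal cost of the player on edge `j` below a node of depth `s`, in the units of that
node. -/
noncomputable def edgeCost (s j : ℕ) : ℝ :=
  marginal kind (T.pattern s).f (j * T.share s) (T.share s)

theorem edgeCost_pos (s j : ℕ) : 0 < T.edgeCost s j := marginal_pos _ _ _ (T.share_pos s)

/-- The total marginal cost of the `N` players below a node of depth `s`, in the units of that
node. -/
noncomputable def totalEdgeCost (s : ℕ) : ℝ := gridCost kind (T.pattern s).f T.N (T.pattern s).k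

theorem sum_edgeCost (s : ℕ) : ∑ j : Fin T.N, T.edgeCost s j = T.totalEdgeCost s := by
  rw [Fin.sum_univ_eq_sum_range (T.edgeCost s)]
  rfl

theorem totalEdgeCost_pos (s : ℕ) : 0 < T.totalEdgeCost s := by
  rw [← sum_edgeCost]
  exact Finset.sum_pos (fun j _ => T.edgeCost_pos s j) ⟨⟨0, T.N_pos⟩, Finset.mem_univ _⟩

/-- The value of a node: the level values of the schedule are distributed among the children of
each node in proportion to the marginal costs of the players on the edges. -/
noncomputable def value : List (Fin T.N) → ℝ
  | [] => T.L 0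
  | j :: v => value v * (T.L (v.length + 1) / T.L v.length) *
      (T.edgeCost v.length j / T.totalEdgeCost v.length)

theorem value_pos (v : List (Fin T.N)) : 0 < T.value v := by
  induction v with
  | nil => exact T.L_pos 0
  | cons j v ih =>
    exact mul_pos (mul_pos ih (div_pos (T.L_pos _) (T.L_pos _)))
      (div_pos (T.edgeCost_pos _ _) (T.totalEdgeCost_pos _))

theorem sum_value (s : ℕ) : ∑ v ∈ levelNodes T.N s, T.value v = T.L s := by
  induction s with
  | zero => simp [levelNodes, value]
  | succ s ih =>
    have h : ∀ v ∈ levelNodes T.N s, ∑ j, T.value (j :: v) = T.value v * (T.L (s + 1) / T.L s) :=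
      fun v hv => by
        have hl := mem_levelNodes.1 hv
        simp only [value, hl]
        rw [← Finset.mul_sum, ← Finset.sum_div, sum_edgeCost,
          div_self (T.totalEdgeCost_pos s).ne', mul_one]
    rw [sum_levelNodes_succ, Finset.sum_congr rfl h, ← Finset.sum_mul, ih,
      mul_div_cancel₀ _ (T.L_pos s).ne']

/-- The load produced by the walk on a node of depth `s` of the tree of depth `m`, in the units of
that node. -/
def walkLoad (m s : ℕ) : ℝ≥0 := if s < m then (T.pattern s).k else 0

/-- The marginal cost of the optimal player of a node, times `1 + ε`, in the units of that node. -/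
def budget (m s : ℕ) : ℝ :=
  (1 + ε) * marginal kind (T.pattern s).f (T.walkLoad m s) (T.pattern s).o

theorem budget_pos (hε : 0 ≤ ε) (m s : ℕ) : 0 < T.budget m s :=
  mul_pos (by linarith) (marginal_pos _ _ _ (T.pattern s).o_pos)

theorem budget_of_lt {m s : ℕ} (h : s < m) : T.budget m s = (T.pattern s).threshold kind ε := by
  rw [budget, walkLoad, if_pos h]
  rfl

theorem budget_self (m : ℕ) : T.budget m m = (1 + ε) * (T.pattern m).optCost := by
  rw [budget, walkLoad, if_neg (lt_irrefl m), marginal_from_zero]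
  rfl

/-- The ordinate scale of a node. -/
noncomputable def height (m : ℕ) (v : List (Fin T.N)) : ℝ :=
  T.value v / (T.unit v.length * T.budget m v.length)

theorem height_pos (hε : 0 ≤ ε) (m : ℕ) (v : List (Fin T.N)) : 0 < T.height m v :=
  div_pos (T.value_pos v) (mul_pos (NNReal.coe_pos.2 (T.unit_pos _)) (T.budget_pos hε _ _))

theorem height_mul_unit (m : ℕ) (v : List (Fin T.N)) :
    T.height m v * T.unit v.length = T.value v / T.budget m v.length := by
  have : (T.unit v.length : ℝ) ≠ 0 := (NNReal.coe_pos.2 (T.unit_pos _)).ne'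
  rw [height]
  field_simp

/-- The total cost of the optimal players of the levels `1, …, m`. -/
theorem sum_opt_le (hε : 0 ≤ ε) {m : ℕ} (hm : 0 < m) :
    ∑ s ∈ Finset.range m, T.L (s + 1) / T.budget m (s + 1) * (T.pattern (s + 1)).optCost ≤
      (∑ s ∈ Finset.range m,
        T.L s / (T.pattern s).threshold kind ε * (T.pattern s).optCost) + T.L m := by
  obtain ⟨n, rfl⟩ := Nat.exists_eq_add_one.2 hm
  rw [Finset.sum_range_succ, Finset.sum_range_succ']
  have h1 : ∑ s ∈ Finset.range n,
      T.L (s + 1) / T.budget (n + 1) (s + 1) * (T.pattern (s + 1)).optCost =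
      ∑ s ∈ Finset.range n, T.L (s + 1) / (T.pattern (s + 1)).threshold kind ε *
        (T.pattern (s + 1)).optCost := Finset.sum_congr rfl fun s hs => by
    rw [T.budget_of_lt (by have := Finset.mem_range.1 hs; omega)]
  have h2 : T.L (n + 1) / T.budget (n + 1) (n + 1) * (T.pattern (n + 1)).optCost ≤
      T.L (n + 1) := by
    have hO := (T.pattern (n + 1)).optCost_pos
    have hL := T.L_pos (n + 1)
    rw [budget_self, div_mul_eq_mul_div, div_le_iff₀ (by positivity)]
    nlinarith [mul_nonneg hε (mul_pos hL hO).le]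
  have h3 : 0 ≤ T.L 0 / (T.pattern 0).threshold kind ε * (T.pattern 0).optCost :=
    mul_nonneg (div_nonneg (T.L_pos 0).le ((T.pattern 0).threshold_pos kind hε).le)
      (T.pattern 0).optCost_pos.le
  rw [h1]
  linarith

/-- In a sufficiently deep tree the gains of the levels outweigh the boundary terms. -/
theorem exists_depth (hε : 0 ≤ ε) (hγ : 0 ≤ γ) : ∃ m, 0 < m ∧
    γ * ∑ s ∈ Finset.range m, T.L (s + 1) / T.budget m (s + 1) * (T.pattern (s + 1)).optCost ≤
      ∑ s ∈ Finset.range m, T.L s / (T.pattern s).threshold kind ε * (T.pattern s).walkCost := by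
  obtain ⟨n, hn⟩ := exists_nat_ge ((T.B + T.x * T.L 0) / T.η)
  rw [div_le_iff₀ T.η_pos] at hn
  refine ⟨n + 1, n.succ_pos, ?_⟩
  refine (mul_le_mul_of_nonneg_left (T.sum_opt_le hε n.succ_pos) hγ).trans ?_
  have h1 := Finset.sum_le_sum fun s (_ : s ∈ Finset.range (n + 1)) => T.gain s
  rw [Finset.sum_add_distrib, ← Finset.mul_sum, Finset.sum_range_sub T.L, Finset.sum_const,
    Finset.card_range, nsmul_eq_mul] at h1
  simp only [mul_sub, Finset.sum_sub_distrib, mul_left_comm _ γ, ← Finset.mul_sum] at h1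
  have h2 := T.bound (n + 1)
  have h3 := T.η_pos
  push_cast at h1
  linarith

/-- A schedule yields a game of ratio at least `γ`: the tree game, with a resource for every node
of depth at most `m`, and a player for every edge, who chooses between its upper end (in the walk)
and its lower end (in the optimum). The players arrive from the leaves to the root. -/
theorem le_classCompetitiveRatio (T : Schedule kind ε C γ) (hε : 0 ≤ ε) (hγ : 0 ≤ γ)
    (hC : ∀ f ∈ C, ∀ a l : ℝ≥0, 0 < a → 0 < l → ∃ g ∈ C, ∀ x, g x = a * f (l * x)) :
    (γ : EReal) ≤ classCompetitiveRatio kind ε (weightedLoadBalancingGames C) := by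
  obtain ⟨m, hm, hratio⟩ := T.exists_depth hε hγ
  have hlat : ∀ v : List (Fin T.N), ∃ g ∈ C, ∀ x, g x =
      (T.height m v).toNNReal * (T.pattern v.length).f ((T.unit v.length)⁻¹ * x) := fun v =>
    hC _ (T.mem _) _ _ (Real.toNNReal_pos.2 (T.height_pos hε m v)) (inv_pos.2 (T.unit_pos _))
  choose lat hlatC hlat using hlat
  have hheight : ∀ v, ((T.height m v).toNNReal : ℝ) = T.height m v := fun v =>
    Real.coe_toNNReal _ (T.height_pos hε m v).le
  have hlatv : ∀ v s, v.length = s → ∀ y, (lat v (T.unit s * y) : ℝ) =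
      T.height m v * (T.pattern s).f y := by
    rintro v _ rfl y
    rw [hlat, inv_mul_cancel_left₀ (T.unit_pos _).ne', NNReal.coe_mul, hheight]
  let P := {v // v ∈ nodesBelow T.N m} × Fin T.N
  let R := {v // v ∈ nodesBelow T.N (m + 1)}
  have hlen : ∀ p : P, p.1.1.length < m := fun p => mem_nodesBelow.1 p.1.2
  let g : P → R := fun p => ⟨p.1.1, mem_nodesBelow.2 ((hlen p).trans m.lt_succ_self)⟩
  let o : P → R := fun p => ⟨p.2 :: p.1.1, mem_nodesBelow.2 (Nat.succ_lt_succ (hlen p))⟩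
  let w : P → ℝ≥0 := fun p => T.unit p.1.1.length * T.share p.1.1.length
  have hg : ∀ p q : P, g q = g p → q.1.1 = p.1.1 := fun _ _ h =>
    congrArg (fun r : R => r.1) h
  have hgo : ∀ p q : P, g q = o p → q.1.1 = p.2 :: p.1.1 := fun _ _ h =>
    congrArg (fun r : R => r.1) h
  have ho : Function.Injective o := fun p q h => by
    obtain ⟨h1, h2⟩ := List.cons.inj (congrArg Subtype.val h)
    exact Prod.ext (Subtype.ext h2) h1
  have hcard : 2 ≤ Fintype.card P := by
    have h0 : ([] : List (Fin T.N)) ∈ nodesBelow T.N m := mem_nodesBelow.2 hm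
    have := Fintype.card_le_of_injective (fun j : Fin T.N => ((⟨[], h0⟩, j) : P))
      fun i j h => congrArg Prod.snd h
    rw [Fintype.card_fin] at this
    exact T.two_le.trans this
  obtain ⟨π, hπ⟩ := exists_equiv_fin_of_rank
    (fun p : P => (m - p.1.1.length) * T.N + p.2)
  -- deeper players come first, siblings in the order of their edges
  have hdeep : ∀ p q : P, p.1.1.length < q.1.1.length → π q < π p := fun p q h => hπ _ _ (by
    have h1 : m - q.1.1.length + 1 ≤ m - p.1.1.length := by have := hlen q; omega
    have h2 := Nat.mul_le_mul_right T.N h1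
    have h3 := q.2.is_lt
    rw [Nat.add_mul, one_mul] at h2
    omega)
  have hsib : ∀ p q : P, g q = g p → (π q < π p ↔ q.2 < p.2) := fun p q h => by
    have h' : q.1.1 = p.1.1 := hg p q h
    have key : ∀ a b : P, a.1.1 = b.1.1 → a.2 < b.2 → π a < π b := fun a b hab hlt =>
      hπ _ _ (by simp only [hab]; exact Nat.add_lt_add_left hlt _)
    refine ⟨fun hlt => ?_, key q p h'⟩
    by_contra! hge
    rcases eq_or_lt_of_le hge with he | hlt'
    · have : q = p := Prod.ext (Subtype.ext h') he.symm
      exact lt_irrefl _ (this ▸ hlt)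
    · exact lt_asymm hlt (key p q h'.symm hlt')
  have hsum : ∀ (p : P) (A : Fin T.N → Prop) [DecidablePred A],
      (∑ q : P with A q.2 ∧ g q = g p, w q) = (Finset.univ.filter A).card * w p := by
    intro p A _
    rw [Finset.sum_filter, Fintype.sum_prod_type, Fintype.sum_eq_single p.1 fun v hv => by
      refine Finset.sum_eq_zero fun j _ => if_neg fun h => hv ?_
      exact Subtype.ext (hg p (v, j) h.2)]
    have : ∀ j, (if A j ∧ g (p.1, j) = g p then w (p.1, j) else 0) = if A j then w p else 0 :=
      fun j => by
        have h1 : g (p.1, j) = g p := rfl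
        have h2 : w (p.1, j) = w p := rfl
        simp only [h1, h2, and_true]
    simp only [this]
    rw [← Finset.sum_filter, Finset.sum_const, nsmul_eq_mul]
  have hloadg : ∀ p, (∑ q with g q = g p, w q) =
      T.unit p.1.1.length * (T.pattern p.1.1.length).k := fun p => by
    have := hsum p (fun _ => True)
    simp only [true_and, Finset.filter_true, Finset.card_univ, Fintype.card_fin] at this
    rw [this, ← T.N_mul_share]
    ring
  have hbefore : ∀ p, (∑ q with π q < π p ∧ g q = g p, w q) =
      T.unit p.1.1.length * ((p.2 : ℕ) * T.share p.1.1.length) := fun p => by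
    have := hsum p (fun j => j < p.2)
    rw [Finset.filter_gt_eq_Iio, Fin.card_Iio] at this
    rw [Finset.filter_congr fun q _ => show π q < π p ∧ g q = g p ↔ q.2 < p.2 ∧ g q = g p from
      and_congr_left (hsib p q), this]
    simp only [w]
    ring
  have hbelow : ∀ p, (∑ q with π q < π p ∧ g q = o p, w q) =
      T.unit (p.1.1.length + 1) * T.walkLoad m (p.1.1.length + 1) := fun p => by
    have h1 : ∀ q, π q < π p ∧ g q = o p ↔ g q = o p := fun q =>
      ⟨fun h => h.2, fun h => ⟨hdeep p q (by
        have h2 : q.1.1 = p.2 :: p.1.1 := hgo p q h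
        rw [h2]
        exact Nat.lt_succ_self _), h⟩⟩
    simp only [h1]
    by_cases hp : p.1.1.length + 1 < m
    · rw [walkLoad, if_pos hp]
      exact hloadg (⟨p.2 :: p.1.1, mem_nodesBelow.2 hp⟩, p.2)
    · rw [walkLoad, if_neg hp, mul_zero]
      refine Finset.sum_eq_zero fun q hq => ?_
      have h2 : q.1.1 = p.2 :: p.1.1 := hgo p q (Finset.mem_filter.1 hq).2
      have h3 := hlen q
      rw [h2] at h3
      exact absurd h3 hp
  refine le_classCompetitiveRatio_of_twoChoice
    (R := {v // v ∈ nodesBelow T.N (m + 1)}) hε hγ hcard (fun r => lat r.1)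
    (fun r => hlatC r.1) w (fun p => mul_pos (T.unit_pos _) (T.share_pos _)) g o ho π
    (fun p => ?_) ?_
  · -- the threshold of the child exceeds the marginal cost on its parent by construction
    set v := p.1.1 with hv
    set s := v.length with hs
    rw [hbefore, hbelow]
    have e1 : marginal kind (lat v) (T.unit s * ((p.2 : ℕ) * T.share s)) (T.unit s * T.share s) =
        T.value v / T.budget m s * T.edgeCost s p.2 := by
      rw [marginal_scale kind (T.unit_pos s) (hlat v), hheight, T.height_mul_unit]
      rfl
    have e2 : (1 + ε) * marginal kind (lat (p.2 :: v)) (T.unit (s + 1) * T.walkLoad m (s + 1))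
        (T.unit s * T.share s) = T.value (p.2 :: v) := by
      rw [← T.unit_succ_mul, marginal_scale kind (T.unit_pos (s + 1)) (hlat (p.2 :: v)), hheight]
      have h1 := T.height_mul_unit m (p.2 :: v)
      rw [List.length_cons] at h1
      rw [h1, mul_left_comm]
      exact div_mul_cancel₀ _ (T.budget_pos hε m (s + 1)).ne'
    change marginal kind (lat v) _ (T.unit s * T.share s) ≤
      (1 + ε) * marginal kind (lat (p.2 :: v)) _ (T.unit s * T.share s)
    rw [e1, e2, value, T.budget_of_lt (hlen p)]
    have hO := (T.pattern s).threshold_pos kind hε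
    have hL := T.L_pos s
    have hS := T.totalEdgeCost_pos s
    have hV := T.value_pos v
    have hE := T.edgeCost_pos s p.2
    have h1 : 1 / (T.pattern s).threshold kind ε ≤ T.L (s + 1) / T.L s / T.totalEdgeCost s := by
      rw [div_div, div_le_div_iff₀ hO (mul_pos hL hS), one_mul]
      exact T.grid_le s
    calc T.value v / (T.pattern s).threshold kind ε * T.edgeCost s p.2
        = T.value v * T.edgeCost s p.2 * (1 / (T.pattern s).threshold kind ε) := by ring
      _ ≤ T.value v * T.edgeCost s p.2 * (T.L (s + 1) / T.L s / T.totalEdgeCost s) := by gcongr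
      _ = _ := by ring
  · have hopt : ∑ p, (w p : ℝ) * lat (o p).1 (w p) = ∑ s ∈ Finset.range m,
        T.L (s + 1) / T.budget m (s + 1) * (T.pattern (s + 1)).optCost := by
      have h1 : ∀ p, (w p : ℝ) * lat (o p).1 (w p) = T.value (p.2 :: p.1.1) /
          T.budget m (p.1.1.length + 1) * (T.pattern (p.1.1.length + 1)).optCost := fun p => by
        have h2 : w p = T.unit (p.1.1.length + 1) * (T.pattern (p.1.1.length + 1)).o :=
          (T.unit_succ_mul _).symm
        have h3 := T.height_mul_unit m (p.2 :: p.1.1)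
        rw [List.length_cons] at h3
        rw [h2, hlatv (o p).1 (p.1.1.length + 1) rfl, ← h3, LoadPattern.optCost]
        push_cast
        ring
      rw [Finset.sum_congr rfl fun p _ => h1 p, Fintype.sum_prod_type,
        Finset.sum_coe_sort (nodesBelow T.N m) (fun v => ∑ j, T.value (j :: v) /
          T.budget m (v.length + 1) * (T.pattern (v.length + 1)).optCost), sum_nodesBelow]
      refine Finset.sum_congr rfl fun s _ => ?_
      rw [← T.sum_value (s + 1), sum_levelNodes_succ, Finset.sum_div, Finset.sum_mul]
      refine Finset.sum_congr rfl fun v hv => ?_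
      rw [mem_levelNodes.1 hv, Finset.sum_div, Finset.sum_mul]
    have hwalk : ∑ p, (w p : ℝ) * lat (g p).1 (∑ q with g q = g p, w q) = ∑ s ∈ Finset.range m,
        T.L s / (T.pattern s).threshold kind ε * (T.pattern s).walkCost := by
      have h1 : ∀ p, (w p : ℝ) * lat (g p).1 (∑ q with g q = g p, w q) =
          T.value p.1.1 / (T.pattern p.1.1.length).threshold kind ε *
            (T.pattern p.1.1.length).walkCost / T.N := fun p => by
        have h3 := T.height_mul_unit m p.1.1
        rw [T.budget_of_lt (hlen p)] at h3
        rw [hloadg, hlatv (g p).1 p.1.1.length rfl, ← h3, LoadPattern.walkCost]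
        simp only [w, share]
        push_cast
        ring
      rw [Finset.sum_congr rfl fun p _ => h1 p, Fintype.sum_prod_type,
        Finset.sum_coe_sort (nodesBelow T.N m) (fun v => ∑ _j : Fin T.N, T.value v /
          (T.pattern v.length).threshold kind ε * (T.pattern v.length).walkCost / T.N),
        sum_nodesBelow]
      refine Finset.sum_congr rfl fun s _ => ?_
      rw [← T.sum_value s, Finset.sum_div, Finset.sum_mul]
      refine Finset.sum_congr rfl fun v hv => ?_
      have hN : (T.N : ℝ) ≠ 0 := by exact_mod_cast T.N_pos.ne'
      rw [mem_levelNodes.1 hv, Finset.sum_const, Finset.card_univ, Fintype.card_fin,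
        nsmul_eq_mul, mul_div_cancel₀ _ hN]
    rw [hopt, hwalk]
    exact hratio

end Schedule

theorem gammaW_le_classCompetitiveRatio {kind : PlayerKind} {ε : ℝ} (hε : 0 ≤ ε)
    {C : Set Latency} (hadm : ∀ f ∈ C, Admissible kind f)
    (hC : ∀ f ∈ C, ∀ a l : ℝ≥0, 0 < a → 0 < l → ∃ g ∈ C, ∀ x, g x = a * f (l * x)) :
    gammaW kind ε (weightedGames C) ≤
      classCompetitiveRatio kind ε (weightedLoadBalancingGames C) := by
  refine EReal.ge_of_forall_gt_iff_ge.1 fun γ hγ => ?_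
  have hex : ∀ x : ℝ, 1 ≤ x → ∃ τ : LoadPattern, τ.f ∈ C ∧
      γ < gammaWAt kind ε x τ.k τ.o τ.f := fun x hx => by
    have h := hγ.trans_le (iInf₂_le x hx)
    simp only [lt_iSup_iff] at h
    obtain ⟨f, ⟨G, hG, e, rfl⟩, k, hk, o, ho, h⟩ := h
    exact ⟨⟨G.latency e, k, o, hk, ho⟩, hG e, EReal.coe_lt_coe_iff.1 h⟩
  -- a pattern with `β > 0` shows that `γ` may be taken to be non-negative
  obtain ⟨τ, hτ, -⟩ := hex 1 le_rfl
  have hex' : ∀ x : ℝ, 1 ≤ x → ∃ τ : LoadPattern, τ.f ∈ C ∧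
      max γ 0 < gammaWAt kind ε x τ.k τ.o τ.f := fun x hx => by
    rcases le_total 0 γ with h0 | h0
    · rw [max_eq_left h0]
      exact hex x hx
    · rw [max_eq_right h0]
      refine ⟨⟨τ.f, 1, 2, one_pos, two_pos⟩, hτ, ?_⟩
      rw [LoadPattern.lt_gammaWAt_iff, zero_mul, sub_zero]
      have h1 := LoadPattern.betaW_one_two_pos hε (hadm _ hτ)
      have h2 := (⟨τ.f, 1, 2, one_pos, two_pos⟩ : LoadPattern).walkCost_pos
      exact add_pos h2 (mul_pos (by linarith) h1)
  obtain ⟨T⟩ := Schedule.exists_of_lt hε hadm (le_max_right γ 0) hex'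
  exact (EReal.coe_le_coe_iff.2 (le_max_left γ 0)).trans
    (T.le_classCompetitiveRatio hε (le_max_right γ 0) hC)

theorem gammaW_eq_classCompetitiveRatio {kind : PlayerKind} {ε : ℝ} (hε : 0 ≤ ε)
    {C : Set Latency} (hadm : ∀ f ∈ C, Admissible kind f)
    (hord : ClosedUnderOrdinateScaling C) (habs : ClosedUnderAbscissaScaling C) :
    gammaW kind ε (weightedGames C) = classCompetitiveRatio kind ε (weightedGames C) ∧
      classCompetitiveRatio kind ε (weightedGames C) =
        classCompetitiveRatio kind ε (weightedLoadBalancingGames C) := by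
  have h1 := classCompetitiveRatio_le_gammaW hε hadm
  have h2 := gammaW_le_classCompetitiveRatio hε hadm fun f hf a l ha hl => by
    obtain ⟨g, hg, hgf⟩ := habs f hf l hl
    obtain ⟨h, hh, hhg⟩ := hord g hg a ha
    exact ⟨h, hh, fun x => by rw [hhg, hgf]⟩
  have h3 : classCompetitiveRatio kind ε (weightedLoadBalancingGames C) ≤
      classCompetitiveRatio kind ε (weightedGames C) := biSup_mono fun G hG => hG.1
  exact ⟨le_antisymm (h2.trans h3) h1, le_antisymm (h1.trans h2) h3⟩

end CongestionGames

theorem theorem2 (ε : ℝ) (hε : 0 ≤ ε) (C : Set CongestionGames.Latency)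
    (hC : ∃ f ∈ C, ¬ f.IsConstant)
    (hord : CongestionGames.ClosedUnderOrdinateScaling C)
    (habs : CongestionGames.ClosedUnderAbscissaScaling C) :
    (CongestionGames.gammaW .selfish ε (CongestionGames.weightedGames C) =
        CongestionGames.classCompetitiveRatio .selfish ε (CongestionGames.weightedGames C) ∧
      CongestionGames.classCompetitiveRatio .selfish ε (CongestionGames.weightedGames C) =
        CongestionGames.classCompetitiveRatio .selfish ε
          (CongestionGames.weightedLoadBalancingGames C)) ∧
    ((∀ f ∈ C, f.SemiConvex) →
      CongestionGames.gammaW .cooperative ε (CongestionGames.weightedGames C) =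
        CongestionGames.classCompetitiveRatio .cooperative ε (CongestionGames.weightedGames C) ∧
      CongestionGames.classCompetitiveRatio .cooperative ε (CongestionGames.weightedGames C) =
        CongestionGames.classCompetitiveRatio .cooperative ε
          (CongestionGames.weightedLoadBalancingGames C)) :=
  ⟨CongestionGames.gammaW_eq_classCompetitiveRatio hε (fun _ _ h => nomatch h) hord habs,
    fun hconv => CongestionGames.gammaW_eq_classCompetitiveRatio hε (fun f hf _ => hconv f hf)
      hord habs⟩
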